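/- **Setting.** Consider a lattice of $n$ sites, each with the same finite-dimensional single-site Hilbert space $\mathcal H_{\rm loc}$, $d=\dim\mathcal H_{\rm loc}$, and $\mathcal H=\mathcal H_{\rm loc}^{\otimes n}$. The system is either (a) a spin or massless-boson system, without superselection rule, or (b) a massive boson system, or (c) a fermion system; in cases (b) and (c) there is a single-site number operator $\hat n$ with eigenvalues in $\mathbb N$, $\hat N=\sum_i\hat n_i$ is the total number operator, and in case (c) parity-changing operators on different sites anticommute. Call a single-site operator *admissible* if it commutes with $\hat n$ in cases (b), (c); in case (a) every single-site operator is admissible. A *physical single-site state* is an admissible density matrix on $\mathcal H_{\rm loc}$, and a *quantum i.i.d. state* is $\hat\rho_{\rm loc}^{\otimes n}$ with $\hat\rho_{\rm loc}$ a physical single-site state. The dynamics is the GKSL equation $$\frac{d\hat\rho}{dt}=\mathcal L(\hat\rho)=-{\rm i}[\hat H,\hat\rho]+\sum_{i=1}^n\sum_{\alpha\in\Gamma_i}\mathcal D_{\hat L_i^{(\alpha)}}(\hat\rho),\qquad \mathcal D_{\hat L}(\hat X)=\hat L\hat X\hat L^\dagger-\tfrac12\{\hat L^\dagger\hat L,\hat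 X\},\quad t\ge 0,$$ where $\hat H$ is a sum of Hermitian operators acting on at most two sites each, the $\Gamma_i$ are finite, and $\hat L_i^{(\alpha)}$ acts on site $i$. In cases (b), (c) the evolution is assumed to obey the superselection rule: a density matrix that commutes with $\hat N$ evolves into density matrices that commute with $\hat N$. With ${\rm Tr}_{\overline{S}}$ the partial trace over all sites outside $S$, put, for $i<j$, $$\hat H_{ij}=\frac{{\rm Tr}_{\overline{ij}}\hat H}{d^{n-2}}-\frac{{\rm Tr}_{\overline i}\hat H}{d^{n-1}}-\frac{{\rm Tr}_{\overline j}\hat H}{d^{n-1}}+\frac{{\rm Tr}\hat H}{d^n},\qquad \hat H_i=\frac{{\rm Tr}_{\overline i}\hat H}{d^{n-1}}-\frac{{\rm Tr}\hat H}{d^n},$$ and let $\mathcal L_i(\hat X)=-{\rm i}[\hat H_i,\hat X]+\sum_{\alpha\in\Gamma_i}\mathcal D_{\hat L_i^{(\alpha)}}(\hat X)$ be the single-site Lindbladian on operators $\hat X$ on $\mathcal H_{\rm loc}$. Let $\mathcal B_{\rm com}$ be the set of operators on $\mathcal H$ that commute with every quantum i.i.d. state. The single-site Lindbladians are *uniform*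 if $\mathcal L_i(\hat\rho_{\rm loc})=\mathcal L_j(\hat\rho_{\rm loc})$ for all sites $i,j$ and all physical single-site states $\hat\rho_{\rm loc}$. **Theorem.** The following two conditions are equivalent. (I) If the initial state is a quantum i.i.d. state, then the state is a quantum i.i.d. state at all times $t\ge 0$. (II) $\hat H_{ij}\in\mathcal B_{\rm com}$ for all $i<j$, and the single-site Lindbladians are uniform. Moreover, the linear span of the physical single-site states is the space of all admissible single-site operators; accordingly, uniformity holds if and only if $\mathcal L_i(\hat X)=\mathcal L_j(\hat X)$ for all sites $i,j$ and all admissible single-site operators $\hat X$. In case (a), for $i<j$, $\hat H_{ij}\in\mathcal B_{\rm com}$ if and only if $\hat H_{ij}\in{\rm span}\{\hat I,\hat P_{ij}\}$, where $\hat P_{ij}$ exchanges the sites $i$ and $j$. -/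

import Mathlib

open scoped Matrix ComplexOrder

noncomputable section

namespace IIDLattice

/-- The kinds of lattice systems.  `ι` labels an orthonormal basis of the single-site Hilbert space.
* `unrestricted`: spins or massless bosons, no superselection rule;
* `boson num`: massive bosons; `ι` labels an occupation-number basis, `num a` is the number of
  particles in the basis state `a`;
* `fermion num`: fermions; as for `boson`, but operators on different sites that both change the
  parity of the particle number anticommute (e.g. `ι = Finset modes`, `num = Finset.card` is the
  Fock space of a site with finitely many internal modes). -/
inductive Kind (ι : Type*) where
  | unrestricted : Kind ι
  | boson (num : ι → ℕ) : Kind ι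
  | fermion (num : ι → ℕ) : Kind ι

/-- Operators on the single-site Hilbert space. -/
abbrev LocOp (ι : Type*) := Matrix ι ι ℂ

/-- Operators on the `n`-fold tensor power of the single-site Hilbert space. -/
abbrev Op (n : ℕ) (ι : Type*) := Matrix (Fin n → ι) (Fin n → ι) ℂ

/-- The single-site number operator. -/
def numberOp {ι : Type*} [DecidableEq ι] (num : ι → ℕ) : LocOp ι :=
  Matrix.diagonal fun a => (num a : ℂ)

/-- The exponent governing exchange signs: the particle number for fermions, `0` otherwise. -/
def Kind.exch {ι : Type*} : Kind ι → ι → ℕ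
  | .unrestricted => fun _ => 0
  | .boson _ => fun _ => 0
  | .fermion num => num

/-- The single-site operator `X` acting on site `i` of the lattice.  For spins and bosons this is
`1 ⊗ ⋯ ⊗ X ⊗ ⋯ ⊗ 1`.  For fermions, in the occupation basis in which the creation operators are
ordered by site, the parity-changing matrix elements of `X` carry the usual sign
`(-1) ^ (number of particles on the sites before i)`. -/
def siteOp {ι : Type*} [DecidableEq ι] {n : ℕ} (K : Kind ι) (i : Fin n) (X : LocOp ι) : Op n ι :=
  Matrix.of fun x y =>
    if ∀ k, k ≠ i → x k = y k then
      (-1 : ℂ) ^ ((K.exch (x i) + K.exch (y i)) * ∑ k ∈ Finset.Iio i, K.exch (x k)) * X (x i) (y i)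
    else 0

/-- The tensor power `ρ ⊗ ⋯ ⊗ ρ`. -/
def iid {ι : Type*} (n : ℕ) (ρ : LocOp ι) : Op n ι :=
  Matrix.of fun x y => ∏ k, ρ (x k) (y k)

/-- Density matrices. -/
def IsDensity {m : Type*} [Fintype m] (ρ : Matrix m m ℂ) : Prop :=
  ρ.PosSemidef ∧ ρ.trace = 1

/-- Single-site operators compatible with the superselection rule (if there is one): those which
commute with the single-site number operator. -/
def Kind.Conserving {ι : Type*} [Fintype ι] [DecidableEq ι] : Kind ι → LocOp ι → Prop
  | .unrestricted => fun _ => True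
  | .boson num => fun X => Commute X (numberOp num)
  | .fermion num => fun X => Commute X (numberOp num)

/-- Many-body operators compatible with the superselection rule (if there is one): those which
commute with the total number operator `∑ i, n_i`. -/
def Kind.TotalConserving {ι : Type*} [Fintype ι] [DecidableEq ι] {n : ℕ} :
    Kind ι → Op n ι → Prop
  | .unrestricted => fun _ => True
  | .boson num => fun X => Commute X (∑ i, siteOp (.boson num) i (numberOp num))
  | .fermion num => fun X => Commute X (∑ i, siteOp (.fermion num) i (numberOp num))

/-- The physical single-site states. -/
def physStates {ι : Type*} [Fintype ι] [DecidableEq ι] (K : Kind ι) : Set (LocOp ι) :=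
  {ρ | IsDensity ρ ∧ K.Conserving ρ}

/-- The algebra of the operators that act on the sites in `S`. -/
def localAlgebra {ι : Type*} [Fintype ι] [DecidableEq ι] {n : ℕ} (K : Kind ι)
    (S : Finset (Fin n)) : Subalgebra ℂ (Op n ι) :=
  Algebra.adjoin ℂ {A | ∃ i ∈ S, ∃ X : LocOp ι, A = siteOp K i X}

/-- `H` is a sum of Hermitian operators each of which acts on at most two sites. -/
def IsTwoBody {ι : Type*} [Fintype ι] [DecidableEq ι] {n : ℕ} (K : Kind ι) (H : Op n ι) : Prop :=
  ∃ h : Finset (Fin n) → Op n ι,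
    (∀ S, S.card ≤ 2 → h S ∈ localAlgebra K S ∧ (h S).IsHermitian) ∧
    H = ∑ S ∈ Finset.univ.filter (fun S : Finset (Fin n) => S.card ≤ 2), h S

/-- The partial trace of `X` over all sites other than `i`, as an operator on the single-site
space: the matrix `Y` with `tr (Eᴴ * Y) = Tr (E_iᴴ * X)` for every single-site matrix unit `E`. -/
def ptrOne {ι : Type*} [Fintype ι] [DecidableEq ι] {n : ℕ} (K : Kind ι) (i : Fin n) (X : Op n ι) :
    LocOp ι :=
  Matrix.of fun a b => ((siteOp K i (Matrix.single a b 1))ᴴ * X).trace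

/-- The partial trace of `X` over all sites other than `i` and `j` (`i ≠ j`), as an operator on the
sites `i` and `j` of the lattice, expanded in the products of matrix units on these two sites. -/
def ptrTwo {ι : Type*} [Fintype ι] [DecidableEq ι] {n : ℕ} (K : Kind ι) (i j : Fin n)
    (X : Op n ι) : Op n ι :=
  ∑ a, ∑ b, ∑ c, ∑ e,
    ((siteOp K i (Matrix.single a b 1) * siteOp K j (Matrix.single c e 1))ᴴ * X).trace •
      (siteOp K i (Matrix.single a b 1) * siteOp K j (Matrix.single c e 1))

/-- The irreducible part of `H` on the two sites `i < j`. -/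
def irrTwo {ι : Type*} [Fintype ι] [DecidableEq ι] {n : ℕ} (K : Kind ι) (H : Op n ι)
    (i j : Fin n) : Op n ι :=
  ((Fintype.card ι : ℂ) ^ (n - 2))⁻¹ • ptrTwo K i j H
    - ((Fintype.card ι : ℂ) ^ (n - 1))⁻¹ • siteOp K i (ptrOne K i H)
    - ((Fintype.card ι : ℂ) ^ (n - 1))⁻¹ • siteOp K j (ptrOne K j H)
    + (H.trace / (Fintype.card ι : ℂ) ^ n) • (1 : Op n ι)

/-- The traceless part of `H` on the single site `i`, as an operator on the single-site space. -/
def irrOne {ι : Type*} [Fintype ι] [DecidableEq ι] {n : ℕ} (K : Kind ι) (H : Op n ι)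
    (i : Fin n) : LocOp ι :=
  ((Fintype.card ι : ℂ) ^ (n - 1))⁻¹ • ptrOne K i H
    - (H.trace / (Fintype.card ι : ℂ) ^ n) • (1 : LocOp ι)

/-- The dissipator of a Lindblad operator `L`. -/
def dissipator {m : Type*} [Fintype m] (L X : Matrix m m ℂ) : Matrix m m ℂ :=
  L * X * Lᴴ - (1 / 2 : ℂ) • (Lᴴ * L * X + X * (Lᴴ * L))

/-- The Lindbladian with Hamiltonian `H` and Lindblad operators `L k`. -/
def lindbladian {m κ : Type*} [Fintype m] [Fintype κ] (H : Matrix m m ℂ) (L : κ → Matrix m m ℂ)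
    (X : Matrix m m ℂ) : Matrix m m ℂ :=
  -Complex.I • (H * X - X * H) + ∑ k, dissipator (L k) X

/-- The Lindbladian of the lattice system with Hamiltonian `H` in which the Lindblad operators
`L i α`, for `α` in the finite label set `Γ i`, act on site `i`. -/
def latticeLindbladian {ι : Type*} [Fintype ι] [DecidableEq ι] {n : ℕ} (K : Kind ι) (H : Op n ι)
    {Γ : Fin n → Type*} [∀ i, Fintype (Γ i)] (L : (i : Fin n) → Γ i → LocOp ι) :
    Op n ι → Op n ι :=
  lindbladian H fun p : (Σ i, Γ i) => siteOp K p.1 (L p.1 p.2)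

/-- The single-site Lindbladian of site `i`. -/
def siteLindbladian {ι : Type*} [Fintype ι] [DecidableEq ι] {n : ℕ} (K : Kind ι) (H : Op n ι)
    {Γ : Fin n → Type*} [∀ i, Fintype (Γ i)] (L : (i : Fin n) → Γ i → LocOp ι) (i : Fin n) :
    LocOp ι → LocOp ι :=
  lindbladian (irrOne K H i) (L i)

/-- `ρ` solves the master equation `dρ/dt = 𝓛 (ρ t)` for `t ≥ 0`. -/
def IsSolution {m : Type*} (𝓛 : Matrix m m ℂ → Matrix m m ℂ) (ρ : ℝ → Matrix m m ℂ) : Prop :=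
  ∀ t, 0 ≤ t → ∀ x y,
    HasDerivWithinAt (fun s => ρ s x y) (𝓛 (ρ t) x y) (Set.Ici 0) t

/-- The time evolution takes density matrices obeying the superselection rule to such density
matrices (no condition if there is no superselection rule). -/
def RespectsSuperselection {ι : Type*} [Fintype ι] [DecidableEq ι] {n : ℕ} (K : Kind ι)
    (𝓛 : Op n ι → Op n ι) : Prop :=
  ∀ ρ : ℝ → Op n ι, IsSolution 𝓛 ρ → IsDensity (ρ 0) → K.TotalConserving (ρ 0) →
    ∀ t, 0 ≤ t → K.TotalConserving (ρ t)

/-- If the initial state is a (physical) i.i.d. state, then the state is a (physical) i.i.d. state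
at all later times. -/
def MaintainsIID {ι : Type*} [Fintype ι] [DecidableEq ι] {n : ℕ} (K : Kind ι)
    (𝓛 : Op n ι → Op n ι) : Prop :=
  ∀ ρ₀ ∈ physStates K, ∀ ρ : ℝ → Op n ι, IsSolution 𝓛 ρ → ρ 0 = iid n ρ₀ →
    ∀ t, 0 ≤ t → ∃ τ ∈ physStates K, ρ t = iid n τ

/-- The set of operators that commute with every (physical) i.i.d. state. -/
def Bcom {ι : Type*} [Fintype ι] [DecidableEq ι] (n : ℕ) (K : Kind ι) : Set (Op n ι) :=
  {A | ∀ ρ ∈ physStates K, Commute A (iid n ρ)}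

/-- The single-site Lindbladians agree on all (physical) single-site states. -/
def IsUniform {ι : Type*} [Fintype ι] [DecidableEq ι] {n : ℕ} (K : Kind ι)
    (ℓ : Fin n → LocOp ι → LocOp ι) : Prop :=
  ∀ i j, ∀ ρ ∈ physStates K, ℓ i ρ = ℓ j ρ

/-- The operator that exchanges the states of the sites `i` and `j` (without exchange signs). -/
def swapOp {ι : Type*} [DecidableEq ι] {n : ℕ} (i j : Fin n) : Op n ι :=
  Matrix.of fun x y => if x = y ∘ Equiv.swap i j then 1 else 0

end IIDLattice

end

open IIDLattice

set_option linter.unusedSectionVars false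

noncomputable section

namespace IIDLattice

variable {ι : Type*} {n : ℕ}

/-! ### Parities and superselection charges -/

/-! Everything rests on a formula for the velocity at an i.i.d. state (`latticeLindbladian_iid`). A
two-body Hamiltonian is a scalar plus traceless one-site terms plus the irreducible terms `irrTwo`
(`two_body_decomposition`). Hence the lattice generator at `iid n ρ` is the sum over sites of
"single-site Lindbladian on one factor, `ρ` on the others", minus `I` times the commutators of the
`irrTwo K H i j` with `iid n ρ`. The map `dressed` expresses the first kind of term and carries the
fermionic exchange strings; physical states preserve parity, so these strings behave well under
multiplication and disappear on conserving operators.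

Sufficiency. If the commutators vanish and the site generators agree on physical states, solve the
single-site equation from `ρ₀`. By the product rule the tensor power of its solution solves the
lattice equation, and uniqueness of solutions identifies the two. The single-site solution must
remain physical: Lindblad evolution preserves positivity (`IsSolution.posSemidef`, a first-contact
argument) and trace, while charge conservation is extracted from the many-body superselection
assumption (`conserving_of_totalConserving_sum`).

Necessity. Differentiating an i.i.d. trajectory at time 0 shows that the velocity is a sum over
sites with one common traceless `σ` (`MaintainsIID.exists_derivative`). At an invertible `ρ`,
multiply the comparison of the two formulas by the inverse of `iid n ρ`. Conjugation by `ρ`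
preserves tracelessness, so the commutators become irreducible two-site operators, and these are
independent of one-site operators (`eq_zero_of_sum_siteOp_eq_sum_irr`). The two parts thus vanish
separately, up to a scalar on each site that the trace excludes (`commute_and_eq_of_invertible`).
Mixing with the maximally mixed state reaches all states, by continuity for the commutators and by
linearity for uniformity.

The span statement is polarization over the fourth roots of unity. Without superselection the
commutant problem reduces to matrices commuting with all `A ⊗ A`; diagonal matrices, permutation
matrices and the all-ones matrix suffice as tests. -/

theorem neg_one_pow_eq_of_cast_eq {a b : ℕ} (h : (a : ZMod 2) = b) : (-1 : ℂ) ^ a = (-1) ^ b := by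
  apply neg_one_pow_congr
  rw [← ZMod.natCast_eq_zero_iff_even, ← ZMod.natCast_eq_zero_iff_even, h]

/-- The conserved charge of a basis state: the particle number, or `0` without superselection. -/
def Kind.charge : Kind ι → ι → ℕ
  | .unrestricted => fun _ => 0
  | .boson num => num
  | .fermion num => num

theorem Kind.exch_eq_of_charge_eq (K : Kind ι) {a b : ι} (h : K.charge a = K.charge b) :
    K.exch a = K.exch b := by
  cases K <;> simp_all [Kind.exch, Kind.charge]

/-- Operators that do not change the exchange parity. -/
def Kind.IsEven (K : Kind ι) (ρ : LocOp ι) : Prop :=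
  ∀ a b, ρ a b ≠ 0 → (K.exch a : ZMod 2) = K.exch b

theorem Kind.isEven_one [DecidableEq ι] (K : Kind ι) : K.IsEven 1 := by
  intro a b h
  by_cases hab : a = b
  · rw [hab]
  · exact absurd (Matrix.one_apply_ne hab) h

/-! ### Sums over configurations -/

section

variable [Fintype ι] [DecidableEq ι]

theorem sum_agree_eq_sum_update (i : Fin n) (x : Fin n → ι) (f : (Fin n → ι) → ℂ) :
    (∑ z, if ∀ k, k ≠ i → x k = z k then f z else 0) = ∑ c, f (Function.update x i c) := by
  rw [← Finset.sum_filter]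
  symm
  apply Finset.sum_nbij (fun c => Function.update x i c)
  · intro c _
    simp only [Finset.mem_filter, Finset.mem_univ, true_and]
    intro k hk
    rw [Function.update_of_ne hk]
  · intro a _ b _ h
    simpa using congrFun h i
  · intro z hz
    simp only [Finset.coe_filter, Finset.mem_univ, true_and, Set.mem_ofPred_eq] at hz
    refine ⟨z i, by simp, ?_⟩
    funext k
    by_cases hk : k = i
    · subst hk; simp
    · simp [Function.update_of_ne hk, hz k hk]
  · intros; rfl

theorem sum_agree_eq_sum_update' (i : Fin n) (y : Fin n → ι) (f : (Fin n → ι) → ℂ) :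
    (∑ z, if ∀ k, k ≠ i → z k = y k then f z else 0) = ∑ c, f (Function.update y i c) := by
  rw [← sum_agree_eq_sum_update]
  simp only [eq_comm]

/-! ### One-site operators dressed with a product operator on the other sites -/

/-- `X` on site `i`, with the exchange string of `siteOp`, times `ρ` on every other site. -/
def dressed (K : Kind ι) (i : Fin n) (ρ : LocOp ι) : LocOp ι →ₗ[ℂ] Op n ι where
  toFun X := Matrix.of fun x y =>
    (-1 : ℂ) ^ ((K.exch (x i) + K.exch (y i)) * ∑ k ∈ Finset.Iio i, K.exch (x k)) *
      (X (x i) (y i) * ∏ k ∈ Finset.univ.erase i, ρ (x k) (y k))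
  map_add' X Y := by
    ext x y
    simp only [Matrix.of_apply, Matrix.add_apply]
    ring
  map_smul' c X := by
    ext x y
    simp only [Matrix.of_apply, Matrix.smul_apply, smul_eq_mul, RingHom.id_apply]
    ring

theorem dressed_apply (K : Kind ι) (i : Fin n) (ρ X : LocOp ι) (x y : Fin n → ι) :
    dressed K i ρ X x y =
    (-1 : ℂ) ^ ((K.exch (x i) + K.exch (y i)) * ∑ k ∈ Finset.Iio i, K.exch (x k)) *
      (X (x i) (y i) * ∏ k ∈ Finset.univ.erase i, ρ (x k) (y k)) := rfl

theorem prod_one_apply_eq_zero {i k : Fin n} (hk : k ≠ i) {x y : Fin n → ι} (h : x k ≠ y k) :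
    ∏ k ∈ Finset.univ.erase i, (1 : LocOp ι) (x k) (y k) = 0 :=
  Finset.prod_eq_zero (i := k) (Finset.mem_erase.2 ⟨hk, Finset.mem_univ k⟩)
    (Matrix.one_apply_ne h)

theorem siteOp_eq_dressed (K : Kind ι) (i : Fin n) (X : LocOp ι) :
    siteOp K i X = dressed K i 1 X := by
  ext x y
  rw [dressed_apply, siteOp, Matrix.of_apply]
  split_ifs with h
  · rw [Finset.prod_eq_one, mul_one]
    intro k hk
    rw [h k (Finset.ne_of_mem_erase hk), Matrix.one_apply_eq]
  · push Not at h
    obtain ⟨k, hk, hne⟩ := h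
    rw [prod_one_apply_eq_zero hk hne]
    simp

/-- The operator on site `i` leaves the sites before `i` unchanged, so both strings have the same
length parity. The intermediate state `c` contributes twice to the exponent and drops out modulo 2.
No evenness of `ρ` is needed on this side. -/
theorem siteOp_mul_dressed (K : Kind ι) (i : Fin n) (ρ A X : LocOp ι) :
    siteOp K i A * dressed K i ρ X = dressed K i ρ (A * X) := by
  ext x y
  rw [Matrix.mul_apply]
  simp only [siteOp, Matrix.of_apply, ite_mul, zero_mul]
  rw [sum_agree_eq_sum_update, dressed_apply, Matrix.mul_apply, Finset.sum_mul, Finset.mul_sum]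
  refine Finset.sum_congr rfl fun c _ => ?_
  rw [dressed_apply]
  have h1 : ∀ k ∈ Finset.univ.erase i, ρ (Function.update x i c k) (y k) = ρ (x k) (y k) :=
    fun k hk => by rw [Function.update_of_ne (Finset.ne_of_mem_erase hk)]
  have h2 : ∀ k ∈ Finset.Iio i, K.exch (Function.update x i c k) = K.exch (x k) :=
    fun k hk => by rw [Function.update_of_ne (Finset.mem_Iio.1 hk).ne]
  rw [Finset.prod_congr rfl h1, Finset.sum_congr rfl h2]
  simp only [Function.update_self]
  set s := ∑ k ∈ Finset.Iio i, K.exch (x k)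
  have h3 : (-1 : ℂ) ^ ((K.exch (x i) + K.exch (y i)) * s) =
      (-1 : ℂ) ^ ((K.exch (x i) + K.exch c) * s) * (-1 : ℂ) ^ ((K.exch c + K.exch (y i)) * s) := by
    rw [← pow_add]
    apply neg_one_pow_eq_of_cast_eq
    push_cast
    have : (2 : ZMod 2) = 0 := rfl
    linear_combination -(K.exch c * s : ZMod 2) * this
  rw [h3]
  ring

/-- Here the string of the right factor is read off the column configuration. Evenness of `ρ` makes
the parity before site `i` the same for rows and columns wherever the entry is nonzero. -/
theorem dressed_mul_siteOp (K : Kind ι) (i : Fin n) {ρ : LocOp ι} (hρ : K.IsEven ρ)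
    (X B : LocOp ι) : dressed K i ρ X * siteOp K i B = dressed K i ρ (X * B) := by
  ext x y
  rw [Matrix.mul_apply]
  simp only [siteOp, Matrix.of_apply, mul_ite, mul_zero]
  rw [sum_agree_eq_sum_update', dressed_apply, Matrix.mul_apply, Finset.sum_mul, Finset.mul_sum]
  refine Finset.sum_congr rfl fun c _ => ?_
  rw [dressed_apply]
  have h1 : ∀ k ∈ Finset.univ.erase i, ρ (x k) (Function.update y i c k) = ρ (x k) (y k) :=
    fun k hk => by rw [Function.update_of_ne (Finset.ne_of_mem_erase hk)]
  have h2 : ∀ k ∈ Finset.Iio i, K.exch (Function.update y i c k) = K.exch (y k) :=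
    fun k hk => by rw [Function.update_of_ne (Finset.mem_Iio.1 hk).ne]
  rw [Finset.prod_congr rfl h1, Finset.sum_congr rfl h2]
  simp only [Function.update_self]
  by_cases h0 : ∏ k ∈ Finset.univ.erase i, ρ (x k) (y k) = 0
  · simp [h0]
  have hs : ((∑ k ∈ Finset.Iio i, K.exch (x k) : ℕ) : ZMod 2) =
      (∑ k ∈ Finset.Iio i, K.exch (y k) : ℕ) := by
    push_cast
    refine Finset.sum_congr rfl fun k hk => hρ _ _ ?_
    exact Finset.prod_ne_zero_iff.1 h0 k
      (Finset.mem_erase.2 ⟨(Finset.mem_Iio.1 hk).ne, Finset.mem_univ k⟩)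
  set s := ∑ k ∈ Finset.Iio i, K.exch (x k)
  set t := ∑ k ∈ Finset.Iio i, K.exch (y k)
  have h3 : (-1 : ℂ) ^ ((K.exch (x i) + K.exch (y i)) * s) =
      (-1 : ℂ) ^ ((K.exch (x i) + K.exch c) * s) * (-1 : ℂ) ^ ((K.exch c + K.exch (y i)) * t) := by
    rw [← pow_add]
    apply neg_one_pow_eq_of_cast_eq
    push_cast [← hs]
    have : (2 : ZMod 2) = 0 := rfl
    linear_combination -(K.exch c * s : ZMod 2) * this
  rw [h3]
  ring

theorem dressed_apply_of_isEven (K : Kind ι) (i : Fin n) {ρ : LocOp ι} (X : LocOp ι)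
    (hX : K.IsEven X)
    (x y : Fin n → ι) : dressed K i ρ X x y =
      X (x i) (y i) * ∏ k ∈ Finset.univ.erase i, ρ (x k) (y k) := by
  rw [dressed_apply]
  by_cases h0 : X (x i) (y i) = 0
  · simp [h0]
  have h := hX _ _ h0
  have h3 : (-1 : ℂ) ^ ((K.exch (x i) + K.exch (y i)) * ∑ k ∈ Finset.Iio i, K.exch (x k)) = 1 := by
    rw [neg_one_pow_eq_of_cast_eq (b := 0), pow_zero]
    push_cast
    have h2 : (2 : ZMod 2) = 0 := rfl
    rw [h]
    linear_combination (K.exch (y i) * ∑ k ∈ Finset.Iio i, (K.exch (x k) : ZMod 2)) * h2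
  rw [h3, one_mul]

/-- This turns products of site operators with an i.i.d. state into the two multiplication rules for
`dressed`. -/
theorem dressed_self_eq_iid (K : Kind ι) (i : Fin n) {ρ : LocOp ι} (hρ : K.IsEven ρ) :
    dressed K i ρ ρ = iid n ρ := by
  ext x y
  rw [dressed_apply_of_isEven K i ρ hρ, iid, Matrix.of_apply,
    Finset.mul_prod_erase _ (fun k => ρ (x k) (y k)) (Finset.mem_univ i)]

theorem siteOp_mul (K : Kind ι) (i : Fin n) (A B : LocOp ι) :
    siteOp K i A * siteOp K i B = siteOp K i (A * B) := by
  rw [siteOp_eq_dressed K i B, siteOp_mul_dressed, siteOp_eq_dressed]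

theorem siteOp_one (K : Kind ι) (i : Fin n) : siteOp K i (1 : LocOp ι) = 1 := by
  rw [siteOp_eq_dressed, dressed_self_eq_iid K i K.isEven_one]
  ext x y
  rw [iid, Matrix.of_apply]
  by_cases h : x = y
  · subst h; simp
  · rw [Matrix.one_apply_ne h]
    obtain ⟨k, hk⟩ := Function.ne_iff.1 h
    exact Finset.prod_eq_zero (Finset.mem_univ k) (Matrix.one_apply_ne hk)

theorem siteOp_conjTranspose (K : Kind ι) (i : Fin n) (A : LocOp ι) :
    (siteOp K i A)ᴴ = siteOp K i Aᴴ := by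
  ext x y
  simp only [siteOp, Matrix.conjTranspose_apply, Matrix.of_apply]
  by_cases h : ∀ k, k ≠ i → x k = y k
  · rw [if_pos h, if_pos fun k hk => (h k hk).symm]
    have h2 : ∀ k ∈ Finset.Iio i, K.exch (y k) = K.exch (x k) :=
      fun k hk => by rw [h k (Finset.mem_Iio.1 hk).ne]
    rw [Finset.sum_congr rfl h2, add_comm (K.exch (y i))]
    simp
  · rw [if_neg h, if_neg fun h' => h fun k hk => (h' k hk).symm, star_zero]

theorem siteOp_add (K : Kind ι) (i : Fin n) (A B : LocOp ι) :
    siteOp K i (A + B) = siteOp K i A + siteOp K i B := by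
  simp only [siteOp_eq_dressed, map_add]

theorem siteOp_smul (K : Kind ι) (i : Fin n) (c : ℂ) (A : LocOp ι) :
    siteOp K i (c • A) = c • siteOp K i A := by
  simp only [siteOp_eq_dressed, map_smul]

theorem siteOp_zero (K : Kind ι) (i : Fin n) : siteOp K i (0 : LocOp ι) = 0 := by
  simp only [siteOp_eq_dressed, map_zero]

theorem siteOp_mul_iid (K : Kind ι) (i : Fin n) {ρ : LocOp ι} (hρ : K.IsEven ρ) (A : LocOp ι) :
    siteOp K i A * iid n ρ = dressed K i ρ (A * ρ) := by
  rw [← dressed_self_eq_iid K i hρ, siteOp_mul_dressed]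

theorem iid_mul_siteOp (K : Kind ι) (i : Fin n) {ρ : LocOp ι} (hρ : K.IsEven ρ) (A : LocOp ι) :
    iid n ρ * siteOp K i A = dressed K i ρ (ρ * A) := by
  rw [← dressed_self_eq_iid K i hρ, dressed_mul_siteOp K i hρ]

/-! ### Tensor products of one-site operators -/

/-- The tensor product of the one-site operators `A k`. -/
def tens (A : Fin n → LocOp ι) : Op n ι := Matrix.of fun x y => ∏ k, A k (x k) (y k)

theorem tens_mul (A B : Fin n → LocOp ι) : tens A * tens B = tens fun k => A k * B k := by
  ext x y
  simp only [tens, Matrix.mul_apply, Matrix.of_apply, ← Finset.prod_mul_distrib]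
  rw [Finset.prod_univ_sum]
  simp

theorem trace_tens (A : Fin n → LocOp ι) : (tens A).trace = ∏ k, (A k).trace := by
  simp only [tens, Matrix.trace, Matrix.diag_apply, Matrix.of_apply]
  rw [Finset.prod_univ_sum]
  simp

theorem iid_mul (A B : LocOp ι) : iid n A * iid n B = iid n (A * B) := tens_mul _ _

theorem trace_iid (A : LocOp ι) : (iid n A).trace = A.trace ^ n := by
  rw [iid, ← tens, trace_tens]; simp

theorem iid_one : iid n (1 : LocOp ι) = 1 := by
  ext x y
  rw [iid, Matrix.of_apply]
  by_cases h : x = y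
  · subst h; simp
  · rw [Matrix.one_apply_ne h]
    obtain ⟨k, hk⟩ := Function.ne_iff.1 h
    exact Finset.prod_eq_zero (Finset.mem_univ k) (Matrix.one_apply_ne hk)

theorem iid_conjTranspose (A : LocOp ι) : (iid n A)ᴴ = iid n Aᴴ := by
  ext x y
  simp [iid, Matrix.conjTranspose_apply]

theorem siteOp_unrestricted (i : Fin n) (X : LocOp ι) :
    siteOp .unrestricted i X = tens (Function.update (fun _ => 1) i X) := by
  ext x y
  rw [siteOp_eq_dressed, dressed_apply, tens, Matrix.of_apply,
    ← Finset.mul_prod_erase _ _ (Finset.mem_univ i)]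
  simp only [Kind.exch, add_zero, zero_mul, pow_zero, one_mul, Function.update_self]
  congr 1
  refine Finset.prod_congr rfl fun k hk => ?_
  rw [Function.update_of_ne (Finset.ne_of_mem_erase hk)]

/-! ### The superselection rule in matrix elements -/

/-- Commuting with a diagonal matrix means being block diagonal in its eigenvalues. The zero charge
of the unrestricted case makes the three kinds uniform. -/
theorem Kind.conserving_iff (K : Kind ι) (X : LocOp ι) :
    K.Conserving X ↔ ∀ a b, X a b ≠ 0 → K.charge a = K.charge b := by
  have key : ∀ num : ι → ℕ, Commute X (numberOp num) ↔ ∀ a b, X a b ≠ 0 → num a = num b := by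
    intro num
    unfold Commute SemiconjBy numberOp
    rw [← Matrix.ext_iff]
    refine forall_congr' fun a => forall_congr' fun b => ?_
    rw [Matrix.mul_diagonal, Matrix.diagonal_mul]
    constructor
    · intro h hne
      rw [mul_comm] at h
      exact_mod_cast (mul_right_cancel₀ hne h).symm
    · intro h
      by_cases h0 : X a b = 0
      · simp [h0]
      · rw [h h0, mul_comm]
  cases K with
  | unrestricted => simp [Kind.Conserving, Kind.charge]
  | boson num => exact key num
  | fermion num => exact key num

theorem siteOp_numberOp (K : Kind ι) (num : ι → ℕ) (i : Fin n) :
    siteOp K i (numberOp num) = Matrix.diagonal fun x => (num (x i) : ℂ) := by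
  have hev : K.IsEven (numberOp num) := by
    intro a b h
    by_cases hab : a = b
    · rw [hab]
    · exact absurd (Matrix.diagonal_apply_ne _ hab) h
  ext x y
  rw [siteOp_eq_dressed, dressed_apply_of_isEven K i _ hev]
  by_cases h : x = y
  · subst h; simp [numberOp]
  · rw [Matrix.diagonal_apply_ne _ h]
    obtain ⟨k, hk⟩ := Function.ne_iff.1 h
    by_cases hki : k = i
    · subst hki
      rw [numberOp, Matrix.diagonal_apply_ne _ hk, zero_mul]
    · rw [prod_one_apply_eq_zero hki hk, mul_zero]

theorem Kind.totalConserving_iff (K : Kind ι) (X : Op n ι) :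
    K.TotalConserving X ↔
      ∀ x y, X x y ≠ 0 → ∑ k, K.charge (x k) = ∑ k, K.charge (y k) := by
  have key : ∀ (K' : Kind ι) (num : ι → ℕ), Commute X (∑ i, siteOp K' i (numberOp num)) ↔
      ∀ x y, X x y ≠ 0 → ∑ k, num (x k) = ∑ k, num (y k) := by
    intro K' num
    have hN : ∑ i, siteOp K' i (numberOp num) =
        Matrix.diagonal fun x : Fin n → ι => ((∑ k, num (x k) : ℕ) : ℂ) := by
      simp only [siteOp_numberOp]
      ext x y
      rw [Matrix.sum_apply]
      by_cases h : x = y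
      · subst h; simp
      · simp [h]
    rw [hN]
    unfold Commute SemiconjBy
    rw [← Matrix.ext_iff]
    refine forall_congr' fun a => forall_congr' fun b => ?_
    rw [Matrix.mul_diagonal, Matrix.diagonal_mul]
    constructor
    · intro h hne
      rw [mul_comm] at h
      exact_mod_cast (mul_right_cancel₀ hne h).symm
    · intro h
      by_cases h0 : X a b = 0
      · simp [h0]
      · rw [h h0, mul_comm]
  cases K with
  | unrestricted => simp [Kind.TotalConserving, Kind.charge]
  | boson num => exact key _ num
  | fermion num => exact key _ num

theorem Kind.Conserving.isEven {K : Kind ι} {X : LocOp ι} (h : K.Conserving X) : K.IsEven X :=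
  fun a b hab => by rw [K.exch_eq_of_charge_eq ((K.conserving_iff X).1 h a b hab)]

theorem Kind.Conserving.iid {K : Kind ι} {X : LocOp ι} (h : K.Conserving X) :
    K.TotalConserving (iid n X) := by
  rw [Kind.totalConserving_iff]
  intro x y hxy
  rw [IIDLattice.iid, Matrix.of_apply, Finset.prod_ne_zero_iff] at hxy
  exact Finset.sum_congr rfl fun k hk => (K.conserving_iff X).1 h _ _ (hxy k hk)

/-- The subalgebra of the operators compatible with the superselection rule. -/
def Kind.conservingSubalgebra (K : Kind ι) : Subalgebra ℂ (LocOp ι) where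
  carrier := {X | K.Conserving X}
  mul_mem' {A B} hA hB := by
    cases K with
    | unrestricted => trivial
    | boson num => exact Commute.mul_left hA hB
    | fermion num => exact Commute.mul_left hA hB
  add_mem' {A B} hA hB := by
    cases K with
    | unrestricted => trivial
    | boson num => exact Commute.add_left hA hB
    | fermion num => exact Commute.add_left hA hB
  algebraMap_mem' c := by
    cases K with
    | unrestricted => trivial
    | boson num => exact Algebra.commutes c _
    | fermion num => exact Algebra.commutes c _

theorem Kind.Conserving.conjTranspose {K : Kind ι} {X : LocOp ι} (h : K.Conserving X) :
    K.Conserving Xᴴ := by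
  rw [Kind.conserving_iff] at h ⊢
  intro a b hab
  rw [Matrix.conjTranspose_apply] at hab
  exact (h b a fun h0 => hab (by rw [h0, star_zero])).symm

end

end IIDLattice

namespace IIDLattice

variable {ι : Type*} {n : ℕ} [Fintype ι] [DecidableEq ι]

/-! ### Traces of products of one-site operators -/

/-- `Y` acts trivially on site `i`, up to the exchange sign of the sites after `i`. -/
def Away (K : Kind ι) (i : Fin n) (Y : Op n ι) : Prop :=
  ∀ x y, (x i ≠ y i → Y x y = 0) ∧ (x i = y i → ∀ a,
    Y (Function.update x i a) (Function.update y i a) =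
      (-1) ^ ((K.exch a + K.exch (x i)) * ∑ k ∈ Finset.Ioi i, (K.exch (x k) + K.exch (y k))) *
        Y x y)

theorem Away.mul {K : Kind ι} {i : Fin n} {Y Z : Op n ι} (hY : Away K i Y) (hZ : Away K i Z) :
    Away K i (Y * Z) := by
  intro x y
  constructor
  · intro h
    rw [Matrix.mul_apply]
    refine Finset.sum_eq_zero fun z _ => ?_
    by_cases hxz : x i = z i
    · rw [(hZ z y).1 fun h' => h (hxz.trans h'), mul_zero]
    · rw [(hY x z).1 hxz, zero_mul]
  · intro h a
    rw [Matrix.mul_apply, Matrix.mul_apply, Finset.mul_sum]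
    -- In the nonzero terms the intermediate configuration agrees with the outer ones at site `i`.
    -- Swapping `a` and `x i` there matches the terms of the two sums; the remaining terms vanish on
    -- both sides.
    let e : (Fin n → ι) ≃ (Fin n → ι) := Equiv.piCongrRight
      (Function.update (fun _ => Equiv.refl ι) i (Equiv.swap a (x i)))
    have he : ∀ z, e z = Function.update z i (Equiv.swap a (x i) (z i)) := by
      intro z
      funext k
      by_cases hk : k = i
      · subst hk; simp [e]
      · simp [e, Function.update_of_ne hk]
    rw [← Equiv.sum_comp e]
    refine Finset.sum_congr rfl fun z _ => ?_
    rw [he]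
    by_cases hz : z i = x i
    · rw [hz, Equiv.swap_apply_right, (hY x z).2 hz.symm a, (hZ z y).2 (hz.trans h) a, hz]
      have : (-1 : ℂ) ^ ((K.exch a + K.exch (x i)) *
          ∑ k ∈ Finset.Ioi i, (K.exch (x k) + K.exch (y k))) =
          (-1 : ℂ) ^ ((K.exch a + K.exch (x i)) *
          ∑ k ∈ Finset.Ioi i, (K.exch (x k) + K.exch (z k))) * (-1 : ℂ) ^ ((K.exch a +
            K.exch (x i)) * ∑ k ∈ Finset.Ioi i, (K.exch (z k) + K.exch (y k))) := by
        rw [← pow_add]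
        apply neg_one_pow_eq_of_cast_eq
        push_cast
        have h2 : (2 : ZMod 2) = 0 := rfl
        simp only [Finset.sum_add_distrib]
        linear_combination -((K.exch a + K.exch (x i)) *
          ∑ k ∈ Finset.Ioi i, (K.exch (z k) : ZMod 2)) * h2
      rw [this]
      ring
    · have h1 : Equiv.swap a (x i) (z i) ≠ a := by
        intro h'
        rw [Equiv.swap_apply_eq_iff, Equiv.swap_apply_left] at h'
        exact hz h'
      rw [(hY x z).1 (Ne.symm hz), (hY _ _).1 (by simpa using h1.symm)]
      simp

/-- If `j` precedes `i`, the string misses site `i` and the parities after `i` cancel. If `j`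
follows `i`, changing the parity at `i` flips the string exactly when the matrix element of `B`
changes parity at `j`. -/
theorem away_siteOp (K : Kind ι) {i j : Fin n} (hij : j ≠ i) (B : LocOp ι) :
    Away K i (siteOp K j B) := by
  intro x y
  simp only [siteOp, Matrix.of_apply]
  constructor
  · intro h
    rw [if_neg fun h' => h (h' i hij.symm)]
  · intro h a
    have hc : (∀ k, k ≠ j → Function.update x i a k = Function.update y i a k) ↔
        ∀ k, k ≠ j → x k = y k := by
      refine forall_congr' fun k => forall_congr' fun hk => ?_
      by_cases hki : k = i
      · subst hki; simp [h]
      · rw [Function.update_of_ne hki, Function.update_of_ne hki]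
    by_cases hxy : ∀ k, k ≠ j → x k = y k
    · rw [if_pos (hc.2 hxy), if_pos hxy, Function.update_of_ne hij, Function.update_of_ne hij,
        ← mul_assoc, ← pow_add]
      congr 1
      apply neg_one_pow_eq_of_cast_eq
      have h2 : (2 : ZMod 2) = 0 := rfl
      have h2' : ∀ z : ZMod 2, z + z = 0 := fun z => by linear_combination z * h2
      push_cast
      rcases lt_or_gt_of_ne hij with hlt | hlt
      · have e1 : ∀ k ∈ Finset.Iio j, (K.exch (Function.update x i a k) : ZMod 2) =
            K.exch (x k) := fun k hk => by
          rw [Function.update_of_ne ((Finset.mem_Iio.1 hk).trans hlt).ne]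
        have e2 : ∀ k ∈ Finset.Ioi i, (K.exch (x k) + K.exch (y k) : ZMod 2) = 0 := fun k hk => by
          rw [hxy k (hlt.trans (Finset.mem_Ioi.1 hk)).ne', h2']
        rw [Finset.sum_congr rfl e1, Finset.sum_congr rfl e2]
        simp
      · have e1 : ∑ k ∈ Finset.Iio j, (K.exch (Function.update x i a k) : ZMod 2) =
            ∑ k ∈ Finset.Iio j, (K.exch (x k) : ZMod 2) + (K.exch a + K.exch (x i)) := by
          rw [← Finset.add_sum_erase _ _ (Finset.mem_Iio.2 hlt),
            ← Finset.add_sum_erase _ (fun k => (K.exch (x k) : ZMod 2)) (Finset.mem_Iio.2 hlt)]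
          have : ∀ k ∈ (Finset.Iio j).erase i, (K.exch (Function.update x i a k) : ZMod 2) =
            K.exch (x k) := fun k hk => by
              rw [Function.update_of_ne (Finset.ne_of_mem_erase hk)]
          rw [Finset.sum_congr rfl this, Function.update_self]
          linear_combination -(K.exch (x i) : ZMod 2) * h2
        have e2 : ∑ k ∈ Finset.Ioi i, (K.exch (x k) + K.exch (y k) : ZMod 2) =
            K.exch (x j) + K.exch (y j) := by
          refine Finset.sum_eq_single_of_mem j (Finset.mem_Ioi.2 hlt) fun k _ hk => ?_
          rw [hxy k hk, h2']
        rw [e1, e2]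
        ring
    · rw [if_neg hxy, if_neg (mt hc.1 hxy), mul_zero]

/-- Only diagonal entries survive, and there the exchange signs are trivial, so the diagonal of `Y`
does not depend on the state of site `i` and the trace factorizes. Multiplying by the dimension
instead of dividing keeps the empty index type admissible. -/
theorem card_mul_trace_siteOp_mul (K : Kind ι) {i : Fin n} {Y : Op n ι} (hY : Away K i Y)
    (A : LocOp ι) :
    (Fintype.card ι : ℂ) * (siteOp K i A * Y).trace = A.trace * Y.trace := by
  have h1 : ∀ x, (siteOp K i A * Y) x x = A (x i) (x i) * Y x x := by
    intro x
    rw [Matrix.mul_apply]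
    rw [Finset.sum_eq_single_of_mem x (Finset.mem_univ x)]
    · congr 1
      rw [siteOp, Matrix.of_apply, if_pos fun _ _ => rfl, neg_one_pow_eq_of_cast_eq (b := 0)]
      · simp
      · push_cast
        have h2 : (2 : ZMod 2) = 0 := rfl
        linear_combination (K.exch (x i) * ∑ k ∈ Finset.Iio i, (K.exch (x k) : ZMod 2)) * h2
    · intro z _ hz
      by_cases h : z i = x i
      · rw [siteOp, Matrix.of_apply, if_neg, zero_mul]
        intro h'
        apply hz
        funext k
        by_cases hk : k = i
        · rw [hk, h]
        · exact (h' k hk).symm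
      · rw [(hY z x).1 h, mul_zero]
  have h3 : ∀ x a, Y (Function.update x i a) (Function.update x i a) = Y x x := by
    intro x a
    rw [(hY x x).2 rfl a, neg_one_pow_eq_of_cast_eq (b := 0)]
    · simp
    · push_cast
      have h2 : (2 : ZMod 2) = 0 := rfl
      rw [Finset.sum_add_distrib]
      linear_combination ((K.exch a + K.exch (x i)) *
        ∑ k ∈ Finset.Ioi i, (K.exch (x k) : ZMod 2)) * h2
  let e := Equiv.funSplitAt i ι
  have h4 : ∀ a b r, Y (e.symm (a, r)) (e.symm (a, r)) = Y (e.symm (b, r)) (e.symm (b, r)) := by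
    intro a b r
    have : e.symm (a, r) = Function.update (e.symm (b, r)) i a := by
      funext k
      by_cases hk : k = i
      · subst hk; simp [e]
      · simp [e, hk]
    rw [this, h3]
  simp only [Matrix.trace, Matrix.diag_apply, h1]
  rw [← Equiv.sum_comp e.symm, ← Equiv.sum_comp e.symm (fun x => Y x x), Fintype.sum_prod_type,
    Fintype.sum_prod_type]
  rcases isEmpty_or_nonempty ι with h | ⟨⟨b⟩⟩
  · simp
  obtain ⟨y, hy⟩ : ∃ y : _ → ℂ, ∀ a r, Y (e.symm (a, r)) (e.symm (a, r)) = y r :=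
    ⟨fun r => Y (e.symm (b, r)) (e.symm (b, r)), fun a r => h4 a b r⟩
  have h6 : ∀ a r, (e.symm (a, r)) i = a := fun a r => by simp [e]
  simp only [h6, hy, ← Finset.mul_sum, ← Finset.sum_mul, Finset.sum_const,
    Finset.card_univ, nsmul_eq_mul]
  ring

section

variable [Nonempty ι]

theorem card_ne_zero_complex : (Fintype.card ι : ℂ) ≠ 0 := by
  exact_mod_cast Fintype.card_ne_zero

theorem trace_siteOp_mul_eq_zero (K : Kind ι) {i : Fin n} {Y : Op n ι} (hY : Away K i Y)
    {A : LocOp ι} (h : A.trace * Y.trace = 0) : (siteOp K i A * Y).trace = 0 := by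
  rw [← card_mul_trace_siteOp_mul K hY A] at h
  exact (mul_eq_zero.1 h).resolve_left card_ne_zero_complex

theorem away_one (K : Kind ι) (i : Fin n) : Away K i (1 : Op n ι) := by
  intro x y
  constructor
  · intro h
    exact Matrix.one_apply_ne fun h' => h (by rw [h'])
  · intro h a
    by_cases hxy : x = y
    · subst hxy
      rw [Matrix.one_apply_eq, Matrix.one_apply_eq, neg_one_pow_eq_of_cast_eq (b := 0)]
      · simp
      · push_cast
        have h2 : (2 : ZMod 2) = 0 := rfl
        rw [Finset.sum_add_distrib]
        linear_combination ((K.exch a + K.exch (x i)) *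
          ∑ k ∈ Finset.Ioi i, (K.exch (x k) : ZMod 2)) * h2
    · rw [Matrix.one_apply_ne hxy, mul_zero, Matrix.one_apply_ne]
      intro h'
      apply hxy
      funext k
      by_cases hk : k = i
      · rw [hk, h]
      · simpa [Function.update_of_ne hk] using congrFun h' k

theorem trace_siteOp (K : Kind ι) (i : Fin n) (A : LocOp ι) :
    (siteOp K i A).trace = (Fintype.card ι : ℂ) ^ (n - 1) * A.trace := by
  have h := card_mul_trace_siteOp_mul K (away_one K i) A
  rw [mul_one, Matrix.trace_one, Fintype.card_fun, Fintype.card_fin] at h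
  have hn : n = (n - 1) + 1 := by have := i.pos; omega
  apply mul_left_cancel₀ (card_ne_zero_complex (ι := ι))
  rw [h]
  nth_rewrite 1 [hn]
  push_cast
  ring

theorem trace_siteOp_mul_siteOp (K : Kind ι) {i j : Fin n} (hij : i ≠ j) (A B : LocOp ι) :
    (siteOp K i A * siteOp K j B).trace = (Fintype.card ι : ℂ) ^ (n - 2) * (A.trace * B.trace) := by
  have h := card_mul_trace_siteOp_mul K (away_siteOp K hij.symm B) A
  have hn : n - 1 = (n - 2) + 1 := by have := i.isLt; have := j.isLt; omega
  apply mul_left_cancel₀ (card_ne_zero_complex (ι := ι))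
  rw [h, trace_siteOp, hn]
  ring

/-! ### Irreducible parts of one- and two-site operators -/

theorem ptrOne_apply (K : Kind ι) (i : Fin n) (X : Op n ι) (a b : ι) :
    ptrOne K i X a b = (siteOp K i (Matrix.single b a 1) * X).trace := by
  rw [ptrOne, Matrix.of_apply, siteOp_conjTranspose, Matrix.conjTranspose_single, star_one]

theorem ptrOne_siteOp_self (K : Kind ι) (i : Fin n) (C : LocOp ι) :
    ptrOne K i (siteOp K i C) = (Fintype.card ι : ℂ) ^ (n - 1) • C := by
  ext a b
  rw [ptrOne_apply, siteOp_mul, trace_siteOp, Matrix.trace_single_mul]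
  simp

theorem ptrOne_one (K : Kind ι) (i : Fin n) :
    ptrOne K i (1 : Op n ι) = (Fintype.card ι : ℂ) ^ (n - 1) • (1 : LocOp ι) := by
  rw [← siteOp_one K i, ptrOne_siteOp_self]

theorem ptrOne_siteOp_of_ne (K : Kind ι) {i k : Fin n} (h : k ≠ i) {C : LocOp ι}
    (hC : C.trace = 0) : ptrOne K i (siteOp K k C) = 0 := by
  ext a b
  rw [ptrOne_apply, trace_siteOp_mul_siteOp K h.symm, hC]
  simp

/-- Whatever the position of `i`, at least one traceless factor sits alone on its site, and the
trace factorizes there. -/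
theorem ptrOne_pair (K : Kind ι) (i : Fin n) {k l : Fin n} (h : k ≠ l) {C D : LocOp ι}
    (hC : C.trace = 0) (hD : D.trace = 0) :
    ptrOne K i (siteOp K k C * siteOp K l D) = 0 := by
  ext a b
  rw [ptrOne_apply, Matrix.zero_apply]
  by_cases hk : k = i
  · subst hk
    rw [← mul_assoc, siteOp_mul, trace_siteOp_mul_siteOp K h, hD]
    simp
  by_cases hl : l = i
  · subst hl
    rw [Matrix.trace_mul_comm, mul_assoc, siteOp_mul, trace_siteOp_mul_siteOp K h, hC]
    simp
  · apply trace_siteOp_mul_eq_zero K ((away_siteOp K hk C).mul (away_siteOp K hl D))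
    rw [trace_siteOp_mul_siteOp K h, hC]
    simp

theorem pair_conjTranspose (K : Kind ι) (i j : Fin n) (a b c e : ι) :
    (siteOp K i (Matrix.single a b 1) * siteOp K j (Matrix.single c e 1))ᴴ =
      siteOp K j (Matrix.single e c 1) * siteOp K i (Matrix.single b a 1) := by
  rw [Matrix.conjTranspose_mul, siteOp_conjTranspose, siteOp_conjTranspose,
    Matrix.conjTranspose_single, Matrix.conjTranspose_single, star_one]

theorem ptrTwo_eq_zero (K : Kind ι) (i j : Fin n) {Z : Op n ι}
    (h : ∀ E F, (siteOp K j F * siteOp K i E * Z).trace = 0) : ptrTwo K i j Z = 0 := by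
  simp only [ptrTwo, pair_conjTranspose, h, zero_smul, Finset.sum_const_zero]

theorem siteOp_eq_sum (K : Kind ι) (i : Fin n) (A : LocOp ι) :
    siteOp K i A = ∑ a, ∑ b, A a b • siteOp K i (Matrix.single a b 1) := by
  nth_rewrite 1 [Matrix.matrix_eq_sum_single A]
  simp only [siteOp_eq_dressed, map_sum, ← map_smul, Matrix.smul_single, smul_eq_mul, mul_one]

/-- Products of matrix units on the two sites are orthogonal for the trace pairing, all with squared
norm `d ^ (n - 2)`; the partial trace is the expansion in this system. -/
theorem ptrTwo_pair (K : Kind ι) {i j : Fin n} (h : i ≠ j) (A B : LocOp ι) :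
    ptrTwo K i j (siteOp K i A * siteOp K j B) =
      (Fintype.card ι : ℂ) ^ (n - 2) • (siteOp K i A * siteOp K j B) := by
  have key : ∀ a b c e, ((siteOp K i (Matrix.single a b 1) * siteOp K j (Matrix.single c e 1))ᴴ *
      (siteOp K i A * siteOp K j B)).trace = (Fintype.card ι : ℂ) ^ (n - 2) * (A a b * B c e) := by
    intro a b c e
    rw [pair_conjTranspose, mul_assoc, ← mul_assoc (siteOp K i _), siteOp_mul,
      Matrix.trace_mul_comm, mul_assoc, siteOp_mul, trace_siteOp_mul_siteOp K h,
      Matrix.trace_single_mul, Matrix.trace_mul_single]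
    simp
  simp only [ptrTwo, key]
  rw [siteOp_eq_sum K i A, siteOp_eq_sum K j B]
  simp only [Finset.sum_mul]
  simp only [Finset.mul_sum, Finset.smul_sum, smul_mul_smul_comm, smul_smul]

theorem ptrTwo_one (K : Kind ι) {i j : Fin n} (h : i ≠ j) :
    ptrTwo K i j (1 : Op n ι) = (Fintype.card ι : ℂ) ^ (n - 2) • (1 : Op n ι) := by
  have := ptrTwo_pair K h 1 1
  simpa only [siteOp_one, mul_one] using this

theorem ptrTwo_siteOp_left (K : Kind ι) {i j : Fin n} (h : i ≠ j) (C : LocOp ι) :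
    ptrTwo K i j (siteOp K i C) = (Fintype.card ι : ℂ) ^ (n - 2) • siteOp K i C := by
  have := ptrTwo_pair K h C 1
  simpa only [siteOp_one, mul_one] using this

theorem ptrTwo_siteOp_right (K : Kind ι) {i j : Fin n} (h : i ≠ j) (C : LocOp ι) :
    ptrTwo K i j (siteOp K j C) = (Fintype.card ι : ℂ) ^ (n - 2) • siteOp K j C := by
  have := ptrTwo_pair K h 1 C
  simpa only [siteOp_one, one_mul] using this

theorem trace_three_eq_zero (K : Kind ι) {i j k : Fin n} (hi : i ≠ k) (hj : j ≠ k)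
    {C : LocOp ι} (hC : C.trace = 0) (E F : LocOp ι) :
    (siteOp K j F * siteOp K i E * siteOp K k C).trace = 0 := by
  rw [Matrix.trace_mul_comm]
  apply trace_siteOp_mul_eq_zero K ((away_siteOp K hj F).mul (away_siteOp K hi E))
  rw [hC, zero_mul]

theorem ptrTwo_siteOp_of_ne (K : Kind ι) {i j k : Fin n} (hi : i ≠ k) (hj : j ≠ k)
    {C : LocOp ι} (hC : C.trace = 0) : ptrTwo K i j (siteOp K k C) = 0 :=
  ptrTwo_eq_zero K i j fun E F => trace_three_eq_zero K hi hj hC E F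

theorem ptrTwo_pair_of_ne (K : Kind ι) {i j k l : Fin n} (hij : i < j) (hkl : k < l)
    (hne : ¬(i = k ∧ j = l)) {C D : LocOp ι} (hC : C.trace = 0) (hD : D.trace = 0) :
    ptrTwo K i j (siteOp K k C * siteOp K l D) = 0 := by
  refine ptrTwo_eq_zero K i j fun E F => ?_
  by_cases hk : i ≠ k ∧ j ≠ k
  · rw [Matrix.trace_mul_comm, mul_assoc]
    apply trace_siteOp_mul_eq_zero K ((away_siteOp K hkl.ne' D).mul
      ((away_siteOp K hk.2 F).mul (away_siteOp K hk.1 E)))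
    rw [hC, zero_mul]
  -- Two distinct ordered pairs of sites cannot cover each other, so once `k` is among `i, j` the
  -- site `l` is not, and its traceless factor kills the trace.
  · have hl : i ≠ l ∧ j ≠ l := by
      constructor
      · rintro rfl
        apply hk
        exact ⟨hkl.ne', (hkl.trans hij).ne'⟩
      · rintro rfl
        apply hk
        exact ⟨fun h => hne ⟨h, rfl⟩, hkl.ne'⟩
    rw [← mul_assoc, Matrix.trace_mul_comm]
    apply trace_siteOp_mul_eq_zero K (((away_siteOp K hl.2 F).mul (away_siteOp K hl.1 E)).mul
      (away_siteOp K hkl.ne C))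
    rw [hD, zero_mul]

end

/-- `ptrOne` as a linear map. -/
def ptrOneLin (K : Kind ι) (i : Fin n) : Op n ι →ₗ[ℂ] LocOp ι where
  toFun := ptrOne K i
  map_add' X Y := by
    ext a b
    simp [ptrOne, mul_add]
  map_smul' c X := by
    ext a b
    simp [ptrOne]

/-- `ptrTwo` as a linear map. -/
def ptrTwoLin (K : Kind ι) (i j : Fin n) : Op n ι →ₗ[ℂ] Op n ι where
  toFun := ptrTwo K i j
  map_add' X Y := by
    simp only [ptrTwo, mul_add, Matrix.trace_add, add_smul, Finset.sum_add_distrib]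
  map_smul' c X := by
    simp only [ptrTwo, Matrix.mul_smul, Matrix.trace_smul, smul_assoc, Finset.smul_sum,
      RingHom.id_apply]

/-- `irrTwo` as a linear map. -/
def irrTwoLin (K : Kind ι) (i j : Fin n) : Op n ι →ₗ[ℂ] Op n ι where
  toFun H := irrTwo K H i j
  map_add' X Y := by
    have h1 : ptrTwo K i j (X + Y) = ptrTwo K i j X + ptrTwo K i j Y :=
      map_add (ptrTwoLin K i j) X Y
    have h2 : ∀ i, ptrOne K i (X + Y) = ptrOne K i X + ptrOne K i Y :=
      fun i => map_add (ptrOneLin K i) X Y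
    simp only [irrTwo, h1, h2, siteOp_add, Matrix.trace_add, add_div, add_smul, smul_add]
    abel
  map_smul' c X := by
    have h1 : ptrTwo K i j (c • X) = c • ptrTwo K i j X := map_smul (ptrTwoLin K i j) c X
    have h2 : ∀ i, ptrOne K i (c • X) = c • ptrOne K i X := fun i => map_smul (ptrOneLin K i) c X
    simp only [irrTwo, h1, h2, siteOp_smul, Matrix.trace_smul, smul_add, smul_sub, smul_eq_mul,
      RingHom.id_apply, mul_div_assoc, mul_smul, smul_comm _ c]

/-- `irrOne` as a linear map. -/
def irrOneLin (K : Kind ι) (i : Fin n) : Op n ι →ₗ[ℂ] LocOp ι where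
  toFun H := irrOne K H i
  map_add' X Y := by
    have h2 : ∀ i, ptrOne K i (X + Y) = ptrOne K i X + ptrOne K i Y :=
      fun i => map_add (ptrOneLin K i) X Y
    simp only [irrOne, h2, Matrix.trace_add, add_div, add_smul, smul_add]
    abel
  map_smul' c X := by
    have h2 : ∀ i, ptrOne K i (c • X) = c • ptrOne K i X := fun i => map_smul (ptrOneLin K i) c X
    simp only [irrOne, h2, Matrix.trace_smul, smul_sub, smul_eq_mul,
      RingHom.id_apply, mul_div_assoc, mul_smul, smul_comm _ c]

section

variable [Nonempty ι]

theorem trace_one_div_card : (1 : Op n ι).trace / (Fintype.card ι : ℂ) ^ n = 1 := by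
  rw [Matrix.trace_one, Fintype.card_fun, Fintype.card_fin]
  push_cast
  exact div_self (pow_ne_zero _ card_ne_zero_complex)

theorem irrOne_one (K : Kind ι) (i : Fin n) : irrOne K (1 : Op n ι) i = 0 := by
  rw [irrOne, ptrOne_one, trace_one_div_card, smul_smul,
    inv_mul_cancel₀ (pow_ne_zero _ card_ne_zero_complex), sub_self]

theorem irrOne_siteOp_self (K : Kind ι) (i : Fin n) {C : LocOp ι} (hC : C.trace = 0) :
    irrOne K (siteOp K i C) i = C := by
  rw [irrOne, ptrOne_siteOp_self, trace_siteOp, hC, smul_smul,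
    inv_mul_cancel₀ (pow_ne_zero _ card_ne_zero_complex)]
  simp

theorem irrOne_siteOp_of_ne (K : Kind ι) {i k : Fin n} (h : k ≠ i) {C : LocOp ι}
    (hC : C.trace = 0) : irrOne K (siteOp K k C) i = 0 := by
  rw [irrOne, ptrOne_siteOp_of_ne K h hC, trace_siteOp, hC]
  simp

theorem irrOne_pair (K : Kind ι) (i : Fin n) {k l : Fin n} (h : k ≠ l) {C D : LocOp ι}
    (hC : C.trace = 0) (hD : D.trace = 0) :
    irrOne K (siteOp K k C * siteOp K l D) i = 0 := by
  rw [irrOne, ptrOne_pair K i h hC hD, trace_siteOp_mul_siteOp K h, hC]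
  simp

theorem irrTwo_one (K : Kind ι) {i j : Fin n} (h : i ≠ j) : irrTwo K (1 : Op n ι) i j = 0 := by
  rw [irrTwo, ptrOne_one, ptrOne_one, ptrTwo_one K h, trace_one_div_card, siteOp_smul, siteOp_smul,
    siteOp_one, siteOp_one, smul_smul, smul_smul,
    inv_mul_cancel₀ (pow_ne_zero _ card_ne_zero_complex),
    inv_mul_cancel₀ (pow_ne_zero _ card_ne_zero_complex)]
  simp

theorem irrTwo_siteOp (K : Kind ι) {i j : Fin n} (h : i ≠ j) (k : Fin n) {C : LocOp ι}
    (hC : C.trace = 0) : irrTwo K (siteOp K k C) i j = 0 := by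
  have hc := inv_mul_cancel₀ (pow_ne_zero (n - 1) (card_ne_zero_complex (ι := ι)))
  have hc' := inv_mul_cancel₀ (pow_ne_zero (n - 2) (card_ne_zero_complex (ι := ι)))
  rw [irrTwo, trace_siteOp, hC]
  by_cases hi : i = k
  · subst hi
    rw [ptrTwo_siteOp_left K h, ptrOne_siteOp_self, ptrOne_siteOp_of_ne K h hC, siteOp_smul,
      smul_smul, smul_smul, hc, hc', siteOp_zero]
    simp
  by_cases hj : j = k
  · subst hj
    rw [ptrTwo_siteOp_right K h, ptrOne_siteOp_self, ptrOne_siteOp_of_ne K h.symm hC, siteOp_smul,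
      smul_smul, smul_smul, hc, hc', siteOp_zero]
    simp
  · rw [ptrTwo_siteOp_of_ne K hi hj hC, ptrOne_siteOp_of_ne K (Ne.symm hi) hC,
      ptrOne_siteOp_of_ne K (Ne.symm hj) hC, siteOp_zero, siteOp_zero]
    simp

theorem irrTwo_pair_self (K : Kind ι) {i j : Fin n} (h : i ≠ j) {C D : LocOp ι}
    (hC : C.trace = 0) (hD : D.trace = 0) :
    irrTwo K (siteOp K i C * siteOp K j D) i j = siteOp K i C * siteOp K j D := by
  rw [irrTwo, ptrTwo_pair K h, ptrOne_pair K i h hC hD, ptrOne_pair K j h hC hD,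
    trace_siteOp_mul_siteOp K h, hC, smul_smul,
    inv_mul_cancel₀ (pow_ne_zero (n - 2) (card_ne_zero_complex (ι := ι))), siteOp_zero, siteOp_zero]
  simp

/-- With the preceding lemmas this makes `irrTwo` the projection of two-body operators onto the
traceless-traceless component of the pair `i, j`. -/
theorem irrTwo_pair_of_ne (K : Kind ι) {i j k l : Fin n} (hij : i < j) (hkl : k < l)
    (hne : ¬(i = k ∧ j = l)) {C D : LocOp ι} (hC : C.trace = 0) (hD : D.trace = 0) :
    irrTwo K (siteOp K k C * siteOp K l D) i j = 0 := by
  rw [irrTwo, ptrTwo_pair_of_ne K hij hkl hne hC hD, ptrOne_pair K i hkl.ne hC hD,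
    ptrOne_pair K j hkl.ne hC hD, trace_siteOp_mul_siteOp K hkl.ne, hC, siteOp_zero, siteOp_zero]
  simp

end

end IIDLattice

namespace IIDLattice

variable {ι : Type*} {n : ℕ} [Fintype ι] [DecidableEq ι] [Nonempty ι]

/-! ### The decomposition of a two-body operator -/

theorem siteOp_mul_siteOp_apply (K : Kind ι) {k l : Fin n} (h : k ≠ l) (A B : LocOp ι)
    (x y : Fin n → ι) : (siteOp K k A * siteOp K l B) x y =
      siteOp K k A x (Function.update x k (y k)) * siteOp K l B (Function.update x k (y k)) y := by
  rw [Matrix.mul_apply, Finset.sum_eq_single_of_mem _ (Finset.mem_univ _)]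
  intro z _ hz
  by_cases h1 : ∀ m, m ≠ k → x m = z m
  · by_cases h2 : z k = y k
    · exfalso
      apply hz
      funext m
      by_cases hm : m = k
      · subst hm; simp [h2]
      · rw [Function.update_of_ne hm, h1 m hm]
    · have : siteOp K l B z y = 0 := by
        rw [siteOp, Matrix.of_apply, if_neg fun h' => h2 (h' k h)]
      rw [this, mul_zero]
  · rw [siteOp, Matrix.of_apply, if_neg h1, zero_mul]

theorem siteOp_swap_apply (K : Kind ι) {k l : Fin n} (h : k < l) (A B : LocOp ι)
    (x y : Fin n → ι) : (siteOp K l B * siteOp K k A) x y =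
      (-1) ^ ((K.exch (x k) + K.exch (y k)) * (K.exch (x l) + K.exch (y l))) *
        (siteOp K k A * siteOp K l B) x y := by
  rw [siteOp_mul_siteOp_apply K h.ne, siteOp_mul_siteOp_apply K h.ne']
  simp only [siteOp, Matrix.of_apply, Function.update_self, Function.update_of_ne h.ne,
    Function.update_of_ne h.ne']
  by_cases hxy : ∀ m, m ≠ k → m ≠ l → x m = y m
  · rw [if_pos, if_pos, if_pos, if_pos]
    · have e1 : ∀ m ∈ Finset.Iio k, K.exch (Function.update x l (y l) m) = K.exch (x m) :=
        fun m hm => by rw [Function.update_of_ne ((Finset.mem_Iio.1 hm).trans h).ne]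
      have e2 : ∑ m ∈ Finset.Iio l, (K.exch (Function.update x k (y k) m) : ZMod 2) =
          ∑ m ∈ Finset.Iio l, (K.exch (x m) : ZMod 2) + (K.exch (y k) + K.exch (x k)) := by
        rw [← Finset.add_sum_erase _ _ (Finset.mem_Iio.2 h),
          ← Finset.add_sum_erase _ (fun m => (K.exch (x m) : ZMod 2)) (Finset.mem_Iio.2 h)]
        have : ∀ m ∈ (Finset.Iio l).erase k, (K.exch (Function.update x k (y k) m) : ZMod 2) =
          K.exch (x m) := fun m hm => by rw [Function.update_of_ne (Finset.ne_of_mem_erase hm)]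
        have h2 : (2 : ZMod 2) = 0 := rfl
        rw [Finset.sum_congr rfl this, Function.update_self]
        linear_combination -(K.exch (x k) : ZMod 2) * h2
      rw [Finset.sum_congr rfl e1]
      set s := ∑ m ∈ Finset.Iio k, K.exch (x m)
      -- `u` and `u'` are the string lengths at `l` before and after the operator on `k` has acted.
      -- Their difference modulo 2 is the parity change at `k`, which produces the exchange sign.
      set u := ∑ m ∈ Finset.Iio l, K.exch (x m) with hu
      set u' := ∑ m ∈ Finset.Iio l, K.exch (Function.update x k (y k) m) with hu'
      have e3 : (-1 : ℂ) ^ ((K.exch (x l) + K.exch (y l)) * u) =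
          (-1) ^ ((K.exch (x k) + K.exch (y k)) * (K.exch (x l) + K.exch (y l))) *
          (-1) ^ ((K.exch (x l) + K.exch (y l)) * u') := by
        rw [← pow_add]
        apply neg_one_pow_eq_of_cast_eq
        rw [hu, hu']
        push_cast
        rw [e2]
        have h2 : (2 : ZMod 2) = 0 := rfl
        linear_combination -((K.exch (x k) + K.exch (y k)) * (K.exch (x l) + K.exch (y l))) * h2
      rw [e3]
      ring
    · intro m hm
      by_cases hk : m = k
      · subst hk; simp
      · rw [Function.update_of_ne hk, hxy m hk hm]
    · intro m hm
      rw [Function.update_of_ne hm]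
    · intro m hm
      by_cases hl : m = l
      · subst hl; simp
      · rw [Function.update_of_ne hl, hxy m hm hl]
    · intro m hm
      rw [Function.update_of_ne hm]
  · push Not at hxy
    obtain ⟨m, hk, hl, hne⟩ := hxy
    rw [if_neg (c := ∀ m, m ≠ k → Function.update x l (y l) m = y m),
      if_neg (c := ∀ m, m ≠ l → Function.update x k (y k) m = y m)]
    · simp
    · intro h'
      apply hne
      rw [← h' m hl, Function.update_of_ne hk]
    · intro h'
      apply hne
      rw [← h' m hk, Function.update_of_ne hl]

/-- A product of matrix units has definite parity changes, so the entrywise sign becomes one overall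
scalar. -/
theorem siteOp_single_swap (K : Kind ι) {k l : Fin n} (h : k < l) (a b c e : ι) :
    siteOp K l (Matrix.single c e 1) * siteOp K k (Matrix.single a b 1) =
      (-1 : ℂ) ^ ((K.exch a + K.exch b) * (K.exch c + K.exch e)) •
        (siteOp K k (Matrix.single a b 1) * siteOp K l (Matrix.single c e 1)) := by
  ext x y
  rw [siteOp_swap_apply K h, Matrix.smul_apply, smul_eq_mul]
  by_cases h0 : (siteOp K k (Matrix.single a b 1) * siteOp K l (Matrix.single c e 1)) x y = 0
  · rw [h0, mul_zero, mul_zero]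
  congr 1
  rw [siteOp_mul_siteOp_apply K h.ne] at h0
  simp only [siteOp, Matrix.of_apply, Function.update_self, Function.update_of_ne h.ne',
    mul_ite, mul_zero, ite_mul, zero_mul, ite_eq_right_iff, Classical.not_imp, mul_eq_zero,
    not_or] at h0
  obtain ⟨-, -, ⟨-, h1⟩, -, h2⟩ := h0
  rw [Matrix.single_apply] at h1 h2
  have h1' : a = x k ∧ b = y k := by by_contra hc; simp [hc] at h1
  have h2' : c = x l ∧ e = y l := by by_contra hc; simp [hc] at h2
  rw [h1'.1, h1'.2, h2'.1, h2'.2]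

/-- The span of the ordered products of an operator on site `k` and one on site `l`. -/
def pairSpan (K : Kind ι) (k l : Fin n) : Submodule ℂ (Op n ι) :=
  Submodule.span ℂ {Z | ∃ A B, Z = siteOp K k A * siteOp K l B}

theorem pair_mem_pairSpan (K : Kind ι) (k l : Fin n) (A B : LocOp ι) :
    siteOp K k A * siteOp K l B ∈ pairSpan K k l := Submodule.subset_span ⟨A, B, rfl⟩

theorem swap_mem_pairSpan (K : Kind ι) {k l : Fin n} (h : k < l) (A B : LocOp ι) :
    siteOp K l B * siteOp K k A ∈ pairSpan K k l := by
  rw [siteOp_eq_sum K l B, siteOp_eq_sum K k A]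
  simp only [Finset.sum_mul]
  simp only [Finset.mul_sum, smul_mul_smul_comm, siteOp_single_swap K h]
  refine sum_mem fun _ _ => sum_mem fun _ _ => sum_mem fun _ _ => sum_mem fun _ _ => ?_
  exact Submodule.smul_mem _ _ (Submodule.smul_mem _ _ (pair_mem_pairSpan K k l _ _))

/-- The span contains 1 and is stable under left multiplication by the generators, hence by the
whole algebra; applying the algebra to 1 gives the inclusion. -/
theorem localAlgebra_pair_le (K : Kind ι) {k l : Fin n} (h : k < l) :
    Subalgebra.toSubmodule (localAlgebra K {k, l} : Subalgebra ℂ (Op n ι)) ≤ pairSpan K k l := by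
  intro Y hY
  have hleft : ∀ X : LocOp ι, ∀ i ∈ ({k, l} : Finset (Fin n)), ∀ Z ∈ pairSpan K k l,
      siteOp K i X * Z ∈ pairSpan K k l := by
    intro X i hi Z hZ
    refine Submodule.span_induction (p := fun Z _ => siteOp K i X * Z ∈ pairSpan K k l)
      ?_ ?_ ?_ ?_ hZ
    · rintro _ ⟨A, B, rfl⟩
      rw [← mul_assoc]
      rcases Finset.mem_insert.1 hi with rfl | hi
      · rw [siteOp_mul]
        exact pair_mem_pairSpan K i l _ _
      · rw [Finset.mem_singleton.1 hi]
        -- A factor on `l` has arrived to the left of one on `k`. Reordering it costs signs only,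
        -- after which the two factors on `l` merge.
        refine Submodule.span_induction
          (p := fun Z _ => Z * siteOp K l B ∈ pairSpan K k l) ?_ ?_ ?_ ?_
          (swap_mem_pairSpan K h A X)
        · rintro _ ⟨C, D, rfl⟩
          rw [mul_assoc, siteOp_mul]
          exact pair_mem_pairSpan K k l _ _
        · simp
        · intro _ _ _ _ h1 h2
          rw [add_mul]
          exact add_mem h1 h2
        · intro c _ _ h1
          rw [smul_mul_assoc]
          exact Submodule.smul_mem _ _ h1
    · simp
    · intro _ _ _ _ h1 h2
      rw [mul_add]
      exact add_mem h1 h2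
    · intro c _ _ h1
      rw [mul_smul_comm]
      exact Submodule.smul_mem _ _ h1
  have key : ∀ Z ∈ pairSpan K k l, Y * Z ∈ pairSpan K k l := by
    refine Algebra.adjoin_induction
      (p := fun Y _ => ∀ Z ∈ pairSpan K k l, Y * Z ∈ pairSpan K k l) ?_ ?_ ?_ ?_ hY
    · rintro _ ⟨i, hi, X, rfl⟩
      exact hleft X i hi
    · intro r Z hZ
      rw [← Algebra.smul_def]
      exact Submodule.smul_mem _ _ hZ
    · intro _ _ _ _ h1 h2 Z hZ
      rw [add_mul]
      exact add_mem (h1 Z hZ) (h2 Z hZ)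
    · intro _ _ _ _ h1 h2 Z hZ
      rw [mul_assoc]
      exact h1 _ (h2 Z hZ)
  have h1 : (1 : Op n ι) ∈ pairSpan K k l := by
    have := pair_mem_pairSpan K k l 1 1
    rwa [siteOp_one, siteOp_one, mul_one] at this
  have := key 1 h1
  rwa [mul_one] at this

theorem mem_localAlgebra_singleton (K : Kind ι) (k : Fin n) {Y : Op n ι}
    (hY : Y ∈ localAlgebra K {k}) : ∃ A, Y = siteOp K k A := by
  refine Algebra.adjoin_induction (p := fun Y _ => ∃ A, Y = siteOp K k A) ?_ ?_ ?_ ?_ hY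
  · rintro _ ⟨i, hi, X, rfl⟩
    rw [Finset.mem_singleton.1 hi]
    exact ⟨X, rfl⟩
  · intro r
    exact ⟨r • 1, by rw [siteOp_smul, siteOp_one, Algebra.algebraMap_eq_smul_one]⟩
  · rintro _ _ _ _ ⟨A, rfl⟩ ⟨B, rfl⟩
    exact ⟨A + B, (siteOp_add K k A B).symm⟩
  · rintro _ _ _ _ ⟨A, rfl⟩ ⟨B, rfl⟩
    exact ⟨A * B, siteOp_mul K k A B⟩

theorem mem_localAlgebra_empty (K : Kind ι) {Y : Op n ι}
    (hY : Y ∈ localAlgebra K (∅ : Finset (Fin n))) : ∃ c : ℂ, Y = c • (1 : Op n ι) := by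
  refine Algebra.adjoin_induction (p := fun Y _ => ∃ c : ℂ, Y = c • (1 : Op n ι)) ?_ ?_ ?_ ?_ hY
  · rintro _ ⟨i, hi, X, rfl⟩
    simp at hi
  · intro r
    exact ⟨r, Algebra.algebraMap_eq_smul_one r⟩
  · rintro _ _ _ _ ⟨a, rfl⟩ ⟨b, rfl⟩
    exact ⟨a + b, (add_smul a b _).symm⟩
  · rintro _ _ _ _ ⟨a, rfl⟩ ⟨b, rfl⟩
    exact ⟨a * b, by rw [smul_mul_smul_comm, mul_one]⟩

/-- The span of the products of traceless operators on the sites `k` and `l`. -/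
def irrSpan (K : Kind ι) (k l : Fin n) : Submodule ℂ (Op n ι) :=
  Submodule.span ℂ {Z | ∃ A B : LocOp ι, A.trace = 0 ∧ B.trace = 0 ∧
    Z = siteOp K k A * siteOp K l B}

theorem irrSpan_le_pairSpan (K : Kind ι) (i j : Fin n) :
    (irrSpan K i j : Submodule ℂ (Op n ι)) ≤ pairSpan K i j :=
  Submodule.span_mono fun _ ⟨A, B, _, _, h⟩ => ⟨A, B, h⟩

/-- The generators of the space of two-body operators. -/
inductive IsTwoBodyGenerator (K : Kind ι) : Op n ι → Prop
  | one : IsTwoBodyGenerator K 1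
  | site (k : Fin n) (A : LocOp ι) (hA : A.trace = 0) : IsTwoBodyGenerator K (siteOp K k A)
  | pair (k l : Fin n) (hkl : k < l) (A B : LocOp ι) (hA : A.trace = 0) (hB : B.trace = 0) :
      IsTwoBodyGenerator K (siteOp K k A * siteOp K l B)

/-- The space of two-body operators. -/
def twoBodySpan (n : ℕ) (K : Kind ι) : Submodule ℂ (Op n ι) :=
  Submodule.span ℂ {Z | IsTwoBodyGenerator K Z}

theorem exists_traceless_add (A : LocOp ι) : ∃ (A' : LocOp ι) (c : ℂ), A'.trace = 0 ∧
    A = A' + c • 1 := by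
  refine ⟨A - (A.trace / Fintype.card ι) • 1, A.trace / Fintype.card ι, ?_, by simp⟩
  rw [Matrix.trace_sub, Matrix.trace_smul, Matrix.trace_one, smul_eq_mul,
    div_mul_cancel₀ _ card_ne_zero_complex, sub_self]

theorem siteOp_mem_twoBodySpan (K : Kind ι) (k : Fin n) (A : LocOp ι) :
    siteOp K k A ∈ twoBodySpan n K := by
  obtain ⟨A', c, hA, rfl⟩ := exists_traceless_add A
  rw [siteOp_add, siteOp_smul, siteOp_one]
  exact add_mem (Submodule.subset_span (.site k A' hA))
    (Submodule.smul_mem _ _ (Submodule.subset_span .one))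

theorem pair_mem_twoBodySpan (K : Kind ι) {k l : Fin n} (h : k < l) (A B : LocOp ι) :
    siteOp K k A * siteOp K l B ∈ twoBodySpan n K := by
  obtain ⟨A', c, hA, rfl⟩ := exists_traceless_add A
  obtain ⟨B', e, hB, rfl⟩ := exists_traceless_add B
  have : siteOp K k (A' + c • 1) * siteOp K l (B' + e • 1) =
      siteOp K k A' * siteOp K l B' + e • siteOp K k A' + c • siteOp K l (B' + e • 1) := by
    simp only [siteOp_add, siteOp_smul, siteOp_one, add_mul, mul_add, mul_smul_comm,
      smul_mul_assoc, one_mul, mul_one, smul_add, smul_comm e c]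
    abel
  rw [this]
  exact add_mem (add_mem (Submodule.subset_span (.pair k l h A' B' hA hB))
    (Submodule.smul_mem _ _ (siteOp_mem_twoBodySpan K k _)))
    (Submodule.smul_mem _ _ (siteOp_mem_twoBodySpan K l _))

theorem localAlgebra_le_twoBodySpan (K : Kind ι) {S : Finset (Fin n)} (hS : S.card ≤ 2)
    {Y : Op n ι} (hY : Y ∈ localAlgebra K S) : Y ∈ twoBodySpan n K := by
  have hpair : ∀ k l : Fin n, k < l → Y ∈ localAlgebra K {k, l} → Y ∈ twoBodySpan n K := by
    intro k l h hY
    refine Submodule.span_le.2 ?_ (localAlgebra_pair_le K h hY)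
    rintro _ ⟨A, B, rfl⟩
    exact pair_mem_twoBodySpan K h A B
  interval_cases hc : S.card
  · rw [Finset.card_eq_zero.1 hc] at hY
    obtain ⟨c, rfl⟩ := mem_localAlgebra_empty K hY
    exact Submodule.smul_mem _ _ (Submodule.subset_span .one)
  · obtain ⟨k, rfl⟩ := Finset.card_eq_one.1 hc
    obtain ⟨A, rfl⟩ := mem_localAlgebra_singleton K k hY
    exact siteOp_mem_twoBodySpan K k A
  · obtain ⟨k, l, hne, rfl⟩ := Finset.card_eq_two.1 hc
    rcases lt_or_gt_of_ne hne with h | h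
    · exact hpair k l h hY
    · rw [Finset.pair_comm] at hY
      exact hpair l k h hY

theorem IsTwoBody.mem_twoBodySpan {K : Kind ι} {H : Op n ι} (hH : IsTwoBody K H) :
    H ∈ twoBodySpan n K := by
  obtain ⟨h, hh, rfl⟩ := hH
  refine sum_mem fun S hS => ?_
  rw [Finset.mem_filter] at hS
  exact localAlgebra_le_twoBodySpan K hS.2 (hh S hS.2).1

theorem IsTwoBody.isHermitian {K : Kind ι} {H : Op n ι} (hH : IsTwoBody K H) :
    H.IsHermitian := by
  obtain ⟨h, hh, rfl⟩ := hH
  rw [Matrix.IsHermitian, Matrix.conjTranspose_sum]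
  refine Finset.sum_congr rfl fun S hS => ?_
  rw [Finset.mem_filter] at hS
  exact (hh S hS.2).2

theorem irrTwo_mem_irrSpan {K : Kind ι} {H : Op n ι} (hH : H ∈ twoBodySpan n K) {i j : Fin n}
    (hij : i < j) : irrTwo K H i j ∈ irrSpan K i j := by
  change irrTwoLin K i j H ∈ _
  refine Submodule.span_induction (p := fun H _ => irrTwoLin K i j H ∈ irrSpan K i j)
    ?_ ?_ ?_ ?_ hH
  · rintro _ (_ | ⟨k, A, hA⟩ | ⟨k, l, hkl, A, B, hA, hB⟩)
    · change irrTwo K 1 i j ∈ _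
      rw [irrTwo_one K hij.ne]
      exact zero_mem _
    · change irrTwo K (siteOp K k A) i j ∈ _
      rw [irrTwo_siteOp K hij.ne k hA]
      exact zero_mem _
    · change irrTwo K (siteOp K k A * siteOp K l B) i j ∈ _
      by_cases hne : i = k ∧ j = l
      · obtain ⟨rfl, rfl⟩ := hne
        rw [irrTwo_pair_self K hij.ne hA hB]
        exact Submodule.subset_span ⟨A, B, hA, hB, rfl⟩
      · rw [irrTwo_pair_of_ne K hij hkl hne hA hB]
        exact zero_mem _
  · simp
  · intro _ _ _ _ h1 h2
    rw [map_add]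
    exact add_mem h1 h2
  · intro c _ _ h1
    rw [map_smul]
    exact Submodule.smul_mem _ _ h1

theorem irrTwo_of_mem_irrSpan {K : Kind ι} {i j k l : Fin n} (hij : i < j) (hkl : k < l)
    {Z : Op n ι} (hZ : Z ∈ irrSpan K k l) :
    irrTwo K Z i j = if i = k ∧ j = l then Z else 0 := by
  change irrTwoLin K i j Z = _
  refine Submodule.span_induction
    (p := fun Z _ => irrTwoLin K i j Z = if i = k ∧ j = l then Z else 0) ?_ ?_ ?_ ?_ hZ
  · rintro _ ⟨A, B, hA, hB, rfl⟩
    change irrTwo K (siteOp K k A * siteOp K l B) i j = _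
    split_ifs with h
    · obtain ⟨rfl, rfl⟩ := h
      exact irrTwo_pair_self K hij.ne hA hB
    · exact irrTwo_pair_of_ne K hij hkl h hA hB
  · simp
  · intro _ _ _ _ h1 h2
    rw [map_add, h1, h2]
    split_ifs <;> simp
  · intro c _ _ h1
    rw [map_smul, h1]
    split_ifs <;> simp

/-- Both sides are linear in `H`, so it is enough to check the generators, on each of which exactly
one of the three terms survives. -/
theorem two_body_decomposition {K : Kind ι} {H : Op n ι} (hH : H ∈ twoBodySpan n K) :
    H = (H.trace / (Fintype.card ι : ℂ) ^ n) • (1 : Op n ι) + ∑ i, siteOp K i (irrOne K H i) +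
      ∑ i, ∑ j ∈ Finset.Ioi i, irrTwo K H i j := by
  refine Submodule.span_induction (p := fun H _ => H =
    (H.trace / (Fintype.card ι : ℂ) ^ n) • (1 : Op n ι) + ∑ i, siteOp K i (irrOne K H i) +
      ∑ i, ∑ j ∈ Finset.Ioi i, irrTwo K H i j) ?_ ?_ ?_ ?_ hH
  · rintro _ (_ | ⟨k, A, hA⟩ | ⟨k, l, hkl, A, B, hA, hB⟩)
    · rw [trace_one_div_card]
      have : ∑ i : Fin n, ∑ j ∈ Finset.Ioi i, irrTwo K (1 : Op n ι) i j = 0 :=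
        Finset.sum_eq_zero fun i _ => Finset.sum_eq_zero fun j hj =>
          irrTwo_one K (Finset.mem_Ioi.1 hj).ne
      simp [this, irrOne_one, siteOp_zero]
    · have h2 : ∑ i : Fin n, ∑ j ∈ Finset.Ioi i, irrTwo K (siteOp K k A) i j = 0 :=
        Finset.sum_eq_zero fun i _ => Finset.sum_eq_zero fun j hj =>
          irrTwo_siteOp K (Finset.mem_Ioi.1 hj).ne k hA
      have h1 : ∑ i, siteOp K i (irrOne K (siteOp K k A) i) = siteOp K k A := by
        rw [Finset.sum_eq_single_of_mem k (Finset.mem_univ k), irrOne_siteOp_self K k hA]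
        intro i _ hi
        rw [irrOne_siteOp_of_ne K hi.symm hA, siteOp_zero]
      rw [h1, h2, trace_siteOp, hA]
      simp
    · have h1 : ∑ i, siteOp K i (irrOne K (siteOp K k A * siteOp K l B) i) = 0 :=
        Finset.sum_eq_zero fun i _ => by rw [irrOne_pair K i hkl.ne hA hB, siteOp_zero]
      have h2 : ∑ i : Fin n, ∑ j ∈ Finset.Ioi i, irrTwo K (siteOp K k A * siteOp K l B) i j =
          siteOp K k A * siteOp K l B := by
        rw [Finset.sum_eq_single_of_mem k (Finset.mem_univ k),
          Finset.sum_eq_single_of_mem l (Finset.mem_Ioi.2 hkl), irrTwo_pair_self K hkl.ne hA hB]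
        · intro j hj hne
          exact irrTwo_pair_of_ne K (Finset.mem_Ioi.1 hj) hkl (fun h => hne h.2) hA hB
        · intro i _ hne
          refine Finset.sum_eq_zero fun j hj => ?_
          exact irrTwo_pair_of_ne K (Finset.mem_Ioi.1 hj) hkl (fun h => hne h.1) hA hB
      rw [h1, h2, trace_siteOp_mul_siteOp K hkl.ne, hA]
      simp
  · have h1 : ∀ i, irrOne K (0 : Op n ι) i = 0 := fun i => map_zero (irrOneLin K i)
    have h2 : ∀ i j, irrTwo K (0 : Op n ι) i j = 0 := fun i j => map_zero (irrTwoLin K i j)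
    simp [h1, h2, siteOp_zero]
  · intro X Y _ _ hX hY
    have h1 : ∀ i, irrOne K (X + Y) i = irrOne K X i + irrOne K Y i :=
      fun i => map_add (irrOneLin K i) X Y
    have h2 : ∀ i j, irrTwo K (X + Y) i j = irrTwo K X i j + irrTwo K Y i j :=
      fun i j => map_add (irrTwoLin K i j) X Y
    nth_rewrite 1 [hX, hY]
    simp only [h1, h2, siteOp_add, Finset.sum_add_distrib, Matrix.trace_add, add_div, add_smul]
    abel
  · intro c X _ hX
    have h1 : ∀ i, irrOne K (c • X) i = c • irrOne K X i :=
      fun i => map_smul (irrOneLin K i) c X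
    have h2 : ∀ i j, irrTwo K (c • X) i j = c • irrTwo K X i j :=
      fun i j => map_smul (irrTwoLin K i j) c X
    nth_rewrite 1 [hX]
    simp only [h1, h2, siteOp_smul, smul_add, Finset.smul_sum, Matrix.trace_smul, smul_eq_mul,
      mul_div_assoc, mul_smul]

/-- One-site operators and irreducible two-site operators are linearly independent. -/
theorem eq_zero_of_sum_siteOp_eq_sum_irr {K : Kind ι} {C : Fin n → LocOp ι}
    {Z : Fin n → Fin n → Op n ι} (hZ : ∀ i j, i < j → Z i j ∈ irrSpan K i j)
    (h : ∑ i, siteOp K i (C i) = ∑ i, ∑ j ∈ Finset.Ioi i, Z i j) :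
    (∀ i j, i < j → Z i j = 0) ∧ ∀ i, ∃ c : ℂ, C i = c • (1 : LocOp ι) := by
  have hZ0 : ∀ i j, i < j → Z i j = 0 := by
    intro i j hij
    -- The projection onto the pair `i, j` annihilates all one-site terms and all other pairs.
    have h' := congrArg (irrTwoLin K i j) h
    rw [map_sum, map_sum, Finset.sum_eq_zero, Finset.sum_eq_single_of_mem i (Finset.mem_univ i),
      map_sum, Finset.sum_eq_single_of_mem j (Finset.mem_Ioi.2 hij)] at h'
    · change 0 = irrTwo K (Z i j) i j at h'
      rw [irrTwo_of_mem_irrSpan hij hij (hZ i j hij), if_pos ⟨rfl, rfl⟩] at h'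
      exact h'.symm
    · intro l hl hne
      change irrTwo K (Z i l) i j = 0
      rw [irrTwo_of_mem_irrSpan hij (Finset.mem_Ioi.1 hl) (hZ i l (Finset.mem_Ioi.1 hl)),
        if_neg fun h => hne h.2.symm]
    · intro k _ hne
      rw [map_sum]
      refine Finset.sum_eq_zero fun l hl => ?_
      change irrTwo K (Z k l) i j = 0
      rw [irrTwo_of_mem_irrSpan hij (Finset.mem_Ioi.1 hl) (hZ k l (Finset.mem_Ioi.1 hl)),
        if_neg fun h => hne h.1.symm]
    · intro k _
      obtain ⟨C', c, hC, hCe⟩ := exists_traceless_add (C k)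
      rw [hCe, siteOp_add, siteOp_smul, siteOp_one, map_add, map_smul]
      change irrTwo K (siteOp K k C') i j + c • irrTwo K 1 i j = 0
      rw [irrTwo_siteOp K hij.ne k hC, irrTwo_one K hij.ne, smul_zero, add_zero]
  refine ⟨hZ0, fun i => ?_⟩
  have h0 : ∑ i, siteOp K i (C i) = 0 := by
    rw [h]
    exact Finset.sum_eq_zero fun i _ => Finset.sum_eq_zero fun j hj =>
      hZ0 i j (Finset.mem_Ioi.1 hj)
  -- The projection onto site `i` sees only traceless parts. Scalars can be moved between sites, so
  -- nothing more than `C i` being scalar can be concluded.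
  have h' := congrArg (irrOneLin K i) h0
  obtain ⟨C', c, hC, hCe⟩ := exists_traceless_add (C i)
  refine ⟨c, ?_⟩
  rw [map_sum, map_zero, Finset.sum_eq_single_of_mem i (Finset.mem_univ i), hCe, siteOp_add,
    siteOp_smul, siteOp_one, map_add, map_smul] at h'
  · change irrOne K (siteOp K i C') i + c • irrOne K 1 i = 0 at h'
    rw [irrOne_siteOp_self K i hC, irrOne_one, smul_zero, add_zero] at h'
    rw [hCe, h', zero_add]
  · intro k _ hne
    obtain ⟨D, e, hD, hDe⟩ := exists_traceless_add (C k)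
    rw [hDe, siteOp_add, siteOp_smul, siteOp_one, map_add, map_smul]
    change irrOne K (siteOp K k D) i + e • irrOne K 1 i = 0
    rw [irrOne_siteOp_of_ne K hne hD, irrOne_one, smul_zero, add_zero]

end IIDLattice

namespace IIDLattice

/-! ### Algebraic properties of Lindbladians -/

section Algebra

variable {m κ : Type*} [Fintype m] [Fintype κ]

/-- `lindbladian` as a linear map. -/
def lindbladianLin (H : Matrix m m ℂ) (L : κ → Matrix m m ℂ) :
    Matrix m m ℂ →ₗ[ℂ] Matrix m m ℂ where
  toFun := lindbladian H L
  map_add' X Y := by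
    have h : ∀ k, dissipator (L k) (X + Y) = dissipator (L k) X + dissipator (L k) Y := by
      intro k
      simp only [dissipator, mul_add, add_mul, smul_add]
      abel
    simp only [lindbladian, h, Finset.sum_add_distrib, mul_add, add_mul, smul_add, smul_sub]
    abel
  map_smul' c X := by
    have h : ∀ k, dissipator (L k) (c • X) = c • dissipator (L k) X := by
      intro k
      simp only [dissipator, mul_smul_comm, smul_mul_assoc, smul_sub, smul_add, smul_comm c]
    simp only [lindbladian, h, ← Finset.smul_sum, mul_smul_comm, smul_mul_assoc, smul_sub,
      smul_add, smul_comm c, RingHom.id_apply]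

theorem lindbladianLin_apply (H : Matrix m m ℂ) (L : κ → Matrix m m ℂ) (X : Matrix m m ℂ) :
    lindbladianLin H L X = lindbladian H L X := rfl

theorem trace_lindbladian (H : Matrix m m ℂ) (L : κ → Matrix m m ℂ) (X : Matrix m m ℂ) :
    (lindbladian H L X).trace = 0 := by
  have h : ∀ k, (dissipator (L k) X).trace = 0 := by
    intro k
    rw [dissipator, Matrix.trace_sub, Matrix.trace_smul, Matrix.trace_add,
      Matrix.trace_mul_comm X, Matrix.trace_mul_comm (L k * X), ← mul_assoc, smul_eq_mul]
    ring
  rw [lindbladian, Matrix.trace_add, Matrix.trace_smul, Matrix.trace_sub, Matrix.trace_mul_comm X,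
    Matrix.trace_sum, Finset.sum_eq_zero fun k _ => h k]
  simp

theorem lindbladian_conjTranspose {H : Matrix m m ℂ} (hH : H.IsHermitian) (L : κ → Matrix m m ℂ)
    (X : Matrix m m ℂ) : (lindbladian H L X)ᴴ = lindbladian H L Xᴴ := by
  have h : ∀ k, (dissipator (L k) X)ᴴ = dissipator (L k) Xᴴ := by
    intro k
    simp only [dissipator, Matrix.conjTranspose_sub, Matrix.conjTranspose_smul,
      Matrix.conjTranspose_add, Matrix.conjTranspose_mul, Matrix.conjTranspose_conjTranspose,
      mul_assoc]
    rw [add_comm]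
    simp
  simp only [lindbladian, h, Matrix.conjTranspose_add, Matrix.conjTranspose_sum,
    Matrix.conjTranspose_smul, Matrix.conjTranspose_sub, Matrix.conjTranspose_mul, hH.eq]
  congr 1
  rw [star_neg, Complex.star_def, Complex.conj_I, neg_neg, neg_smul, ← smul_neg, neg_sub]

/-- On a kernel vector of `X` every term with `X` at an outer end vanishes, and only the gain terms
`L X Lᴴ` remain. This says that the generator points inward at the boundary of the positive cone. -/
theorem zero_le_lindbladian_of_mulVec_eq_zero (H : Matrix m m ℂ) (L : κ → Matrix m m ℂ)
    {X : Matrix m m ℂ} (hX : X.PosSemidef) {v : m → ℂ} (hv : X *ᵥ v = 0) :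
    0 ≤ star v ⬝ᵥ (lindbladian H L X *ᵥ v) := by
  have hv' : star v ᵥ* X = 0 := by
    have := congrArg star hv
    rwa [Matrix.star_mulVec, star_zero, hX.isHermitian.eq] at this
  have e1 : ∀ A, star v ⬝ᵥ ((A * X) *ᵥ v) = 0 := fun A => by
    rw [← Matrix.mulVec_mulVec, hv, Matrix.mulVec_zero, dotProduct_zero]
  have e2 : ∀ A, star v ⬝ᵥ ((X * A) *ᵥ v) = 0 := fun A => by
    rw [Matrix.dotProduct_mulVec, ← Matrix.vecMul_vecMul, hv', Matrix.zero_vecMul, zero_dotProduct]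
  have h : ∀ k, 0 ≤ star v ⬝ᵥ (dissipator (L k) X *ᵥ v) := by
    intro k
    rw [dissipator, Matrix.sub_mulVec, dotProduct_sub, Matrix.smul_mulVec, dotProduct_smul,
      Matrix.add_mulVec, dotProduct_add, e1, e2, add_zero, smul_zero, sub_zero]
    exact (hX.mul_mul_conjTranspose_same (L k)).dotProduct_mulVec_nonneg v
  rw [lindbladian, Matrix.add_mulVec, dotProduct_add, Matrix.smul_mulVec, dotProduct_smul,
    Matrix.sub_mulVec, dotProduct_sub, e1, e2, sub_zero, smul_zero, zero_add, Matrix.sum_mulVec,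
    dotProduct_sum]
  exact Finset.sum_nonneg fun k _ => h k

end Algebra

/-! ### Linear matrix differential equations -/

section ODE

attribute [local instance] Matrix.normedAddCommGroup Matrix.normedSpace

variable {m : Type*} [Fintype m]

theorem hasDerivWithinAt_matrix {ρ : ℝ → Matrix m m ℂ} {ρ' : Matrix m m ℂ} {s : Set ℝ} {t : ℝ} :
    HasDerivWithinAt ρ ρ' s t ↔ ∀ x y, HasDerivWithinAt (fun u => ρ u x y) (ρ' x y) s t := by
  have h1 := hasDerivWithinAt_pi (𝕜 := ℝ) (φ := ρ) (φ' := ρ') (s := s) (x := t)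
    (E' := fun _ : m => m → ℂ)
  refine h1.trans (forall_congr' fun x => ?_)
  exact hasDerivWithinAt_pi (𝕜 := ℝ) (φ := fun u => ρ u x) (φ' := ρ' x) (s := s) (x := t)
    (E' := fun _ : m => ℂ)

theorem isSolution_iff {ℓ : Matrix m m ℂ → Matrix m m ℂ} {ρ : ℝ → Matrix m m ℂ} :
    IsSolution ℓ ρ ↔ ∀ t, 0 ≤ t → HasDerivWithinAt ρ (ℓ (ρ t)) (Set.Ici 0) t :=
  forall_congr' fun _ => forall_congr' fun _ => hasDerivWithinAt_matrix.symm

theorem IsSolution.hasDerivWithinAt_map {ℓ : Matrix m m ℂ → Matrix m m ℂ}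
    {ρ : ℝ → Matrix m m ℂ} (h : IsSolution ℓ ρ) {E : Type*} [NormedAddCommGroup E]
    [NormedSpace ℝ E] (φ : Matrix m m ℂ →ₗ[ℝ] E) {t : ℝ} (ht : 0 ≤ t) :
    HasDerivWithinAt (fun s => φ (ρ s)) (φ (ℓ (ρ t))) (Set.Ici 0) t :=
  (LinearMap.toContinuousLinearMap φ).hasFDerivAt.comp_hasDerivWithinAt t
    (isSolution_iff.1 h t ht)

theorem IsSolution.continuousOn {ℓ : Matrix m m ℂ → Matrix m m ℂ}
    {ρ : ℝ → Matrix m m ℂ} (h : IsSolution ℓ ρ) : ContinuousOn ρ (Set.Ici 0) :=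
  fun t ht => (isSolution_iff.1 h t ht).continuousWithinAt

theorem exists_linear_ode {E : Type*} [NormedAddCommGroup E] [NormedSpace ℝ E]
    [CompleteSpace E] (f : E →L[ℝ] E) (x₀ : E) :
    ∃ g : ℝ → E, (∀ t, HasDerivAt g (f (g t)) t) ∧ g 0 = x₀ := by
  let g : ℝ → E := fun t => NormedSpace.exp (t • f) x₀
  have hg : ∀ t, HasDerivAt g (f (g t)) t := by
    intro t
    have h := hasDerivAt_exp_smul_const' (𝕂 := ℝ) f t
    exact h.clm_apply (hasDerivAt_const t x₀) |>.congr_deriv (by simp [g])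
  exact ⟨g, hg, by simp [g]⟩

/-- Solving the restricted equation inside `V` gives both the solution and its confinement. -/
theorem exists_linear_ode_mem {E : Type*} [NormedAddCommGroup E] [NormedSpace ℝ E]
    [FiniteDimensional ℝ E] (f : E →ₗ[ℝ] E) (V : Submodule ℝ E) (hV : ∀ x ∈ V, f x ∈ V) {x₀ : E}
    (h₀ : x₀ ∈ V) : ∃ g : ℝ → E, (∀ t, HasDerivAt g (f (g t)) t) ∧ g 0 = x₀ ∧ ∀ t, g t ∈ V := by
  have : CompleteSpace V := FiniteDimensional.complete ℝ V
  obtain ⟨g, h1, h2⟩ := exists_linear_ode (LinearMap.toContinuousLinearMap (f.restrict hV)) ⟨x₀, h₀⟩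
  refine ⟨fun t => (g t : E), fun t => ?_, by simp [h2], fun t => (g t).2⟩
  exact V.subtypeL.hasFDerivAt.comp_hasDerivAt t (h1 t)

/-- A linear equation that preserves a subspace has solutions in this subspace. -/
theorem exists_isSolution_mem (ℓ : Matrix m m ℂ →ₗ[ℂ] Matrix m m ℂ)
    (V : Submodule ℂ (Matrix m m ℂ)) (hV : ∀ X ∈ V, ℓ X ∈ V) {ρ₀ : Matrix m m ℂ} (h₀ : ρ₀ ∈ V) :
    ∃ ρ : ℝ → Matrix m m ℂ, IsSolution ℓ ρ ∧ ρ 0 = ρ₀ ∧ ∀ t, ρ t ∈ V := by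
  obtain ⟨g, h1, h2, h3⟩ := exists_linear_ode_mem (ℓ.restrictScalars ℝ) (V.restrictScalars ℝ) hV h₀
  exact ⟨g, isSolution_iff.2 fun t _ => (h1 t).hasDerivWithinAt, h2, h3⟩

theorem exists_isSolution (ℓ : Matrix m m ℂ →ₗ[ℂ] Matrix m m ℂ) (ρ₀ : Matrix m m ℂ) :
    ∃ ρ : ℝ → Matrix m m ℂ, IsSolution ℓ ρ ∧ ρ 0 = ρ₀ := by
  obtain ⟨ρ, h1, h2, -⟩ := exists_isSolution_mem ℓ ⊤ (fun _ _ => trivial) (ρ₀ := ρ₀) trivial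
  exact ⟨ρ, h1, h2⟩

theorem IsSolution.unique {ℓ : Matrix m m ℂ →ₗ[ℂ] Matrix m m ℂ} {ρ τ : ℝ → Matrix m m ℂ}
    (hρ : IsSolution ℓ ρ) (hτ : IsSolution ℓ τ) (h0 : ρ 0 = τ 0) {t : ℝ} (ht : 0 ≤ t) :
    ρ t = τ t := by
  let f : Matrix m m ℂ →L[ℝ] Matrix m m ℂ :=
    LinearMap.toContinuousLinearMap (ℓ.restrictScalars ℝ)
  have hd : ∀ {σ : ℝ → Matrix m m ℂ}, IsSolution ℓ σ →
      ∀ s ∈ Set.Ico 0 t, HasDerivWithinAt σ (f (σ s)) (Set.Ici s) s := fun hσ s hs =>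
    (isSolution_iff.1 hσ s hs.1).mono (Set.Ici_subset_Ici.2 hs.1)
  exact ODE_solution_unique (v := fun _ => f) (a := 0) (b := t) (fun _ => f.lipschitz)
    (hρ.continuousOn.mono fun s hs => hs.1) (hd hρ) (hτ.continuousOn.mono fun s hs => hs.1) (hd hτ)
    h0 ⟨ht, le_rfl⟩

theorem IsSolution.conjTranspose {ℓ : Matrix m m ℂ → Matrix m m ℂ}
    (hℓ : ∀ X, (ℓ X)ᴴ = ℓ Xᴴ) {ρ : ℝ → Matrix m m ℂ} (h : IsSolution ℓ ρ) :
    IsSolution ℓ fun t => (ρ t)ᴴ := by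
  intro t ht x y
  rw [← hℓ]
  exact (h t ht y x).star

/-! ### Positivity of the evolution -/

/-- Homogeneity of the quadratic form reduces positivity to a compact set, which the first-contact
argument needs. The sphere is that of the sup norm on `m → ℂ`, which serves equally well. -/
theorem posSemidef_of_sphere {X : Matrix m m ℂ} (hX : X.IsHermitian)
    (h : ∀ v ∈ Metric.sphere (0 : m → ℂ) 1, 0 ≤ (star v ⬝ᵥ (X *ᵥ v)).re) : X.PosSemidef := by
  refine .of_dotProduct_mulVec_nonneg hX fun v => ?_
  rw [Complex.nonneg_iff]
  constructor
  · by_cases hv : v = 0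
    · simp [hv]
    have hn : ‖v‖ ≠ 0 := norm_ne_zero_iff.2 hv
    have h1 := h ((‖v‖⁻¹ : ℝ) • v) (by simp [norm_smul, hn])
    have h2 : star v ⬝ᵥ (X *ᵥ v) = ((‖v‖ ^ 2 : ℝ) : ℂ) *
        (star ((‖v‖⁻¹ : ℝ) • v) ⬝ᵥ (X *ᵥ ((‖v‖⁻¹ : ℝ) • v))) := by
      rw [star_smul, Matrix.mulVec_smul, dotProduct_smul, smul_dotProduct, star_trivial ‖v‖⁻¹,
        Complex.real_smul, Complex.real_smul, ← mul_assoc, ← mul_assoc, ← Complex.ofReal_mul,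
        ← Complex.ofReal_mul]
      have : ‖v‖ ^ 2 * ‖v‖⁻¹ * ‖v‖⁻¹ = 1 := by field_simp
      rw [this, Complex.ofReal_one, one_mul]
    rw [h2, Complex.re_ofReal_mul]
    positivity
  · exact (hX.im_star_dotProduct_mulVec_self v).symm

theorem quadraticForm_one_pos [DecidableEq m] :
    ∀ v ∈ Metric.sphere (0 : m → ℂ) 1, 0 < (star v ⬝ᵥ ((1 : Matrix m m ℂ) *ᵥ v)).re := by
  intro v hv
  have hv0 : v ≠ 0 := by
    rintro rfl
    simp at hv
  exact (Complex.pos_iff.1 (Matrix.PosDef.one.dotProduct_mulVec_pos hv0)).1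

theorem continuousOn_quadraticForm {σ : ℝ → Matrix m m ℂ} {s : Set ℝ}
    (h : ∀ i j, ContinuousOn (fun t => σ t i j) s) :
    ContinuousOn (fun p : ℝ × (m → ℂ) => (star p.2 ⬝ᵥ (σ p.1 *ᵥ p.2)).re) (s ×ˢ Set.univ) := by
  simp only [dotProduct, Matrix.mulVec, Pi.star_apply]
  refine Complex.continuous_re.comp_continuousOn (continuousOn_finsetSum _ fun i _ => ?_)
  refine ContinuousOn.mul (by fun_prop) (continuousOn_finsetSum _ fun j _ => ?_)
  exact ((h i j).comp continuousOn_fst fun p hp => hp.1).mul (by fun_prop)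

variable {κ : Type*} [Fintype κ]

/-- First-contact argument for the perturbation `ρ t + ε * exp (c * t)` times the identity. The rate
`c` strictly dominates the action of the generator on the identity, so at a first contact with the
boundary the form would be strictly increasing, although it was positive before. -/
theorem IsSolution.pos_of_lindbladian [DecidableEq m] {H : Matrix m m ℂ}
    {L : κ → Matrix m m ℂ} {ρ : ℝ → Matrix m m ℂ} (hρ : IsSolution (lindbladian H L) ρ)
    (h0 : (ρ 0).PosSemidef) (hherm : ∀ t, 0 ≤ t → (ρ t).IsHermitian) {c : ℝ}
    (hc : ∀ v ∈ Metric.sphere (0 : m → ℂ) 1,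
      (star v ⬝ᵥ (lindbladian H L 1 *ᵥ v)).re < c * (star v ⬝ᵥ ((1 : Matrix m m ℂ) *ᵥ v)).re)
    {ε : ℝ} (hε : 0 < ε) {T : ℝ} (hT : 0 ≤ T) {v : m → ℂ} (hv : v ∈ Metric.sphere (0 : m → ℂ) 1) :
    0 < (star v ⬝ᵥ ((ρ T + ((ε * Real.exp (c * T) : ℝ) : ℂ) • 1) *ᵥ v)).re := by
  set σ : ℝ → Matrix m m ℂ := fun t => ρ t + ((ε * Real.exp (c * t) : ℝ) : ℂ) • 1 with hσ
  set q : ℝ × (m → ℂ) → ℝ := fun p => (star p.2 ⬝ᵥ (σ p.1 *ᵥ p.2)).re with hq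
  have hone := quadraticForm_one_pos (m := m)
  have hqs : ∀ (t : ℝ) (v : m → ℂ), q (t, v) = (star v ⬝ᵥ (ρ t *ᵥ v)).re +
      ε * Real.exp (c * t) * (star v ⬝ᵥ ((1 : Matrix m m ℂ) *ᵥ v)).re := by
    intro t v
    simp only [hq, hσ, Matrix.add_mulVec, Matrix.smul_mulVec, dotProduct_add, dotProduct_smul,
      Complex.add_re, smul_eq_mul, Complex.re_ofReal_mul]
  have hqc : ContinuousOn q (Set.Ici 0 ×ˢ Set.univ) := by
    refine continuousOn_quadraticForm fun i j => ?_
    have h1 : ContinuousOn (fun t => ρ t i j) (Set.Ici 0) :=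
      fun t ht => (hρ t ht i j).continuousWithinAt
    simp only [hσ, Matrix.add_apply, Matrix.smul_apply, smul_eq_mul]
    fun_prop
  by_contra! hneg
  let B : Set (ℝ × (m → ℂ)) := Set.Icc 0 T ×ˢ Metric.sphere 0 1
  have hB : IsCompact B := isCompact_Icc.prod (isCompact_sphere _ _)
  have hqB : ContinuousOn q B := hqc.mono fun p hp => ⟨hp.1.1, trivial⟩
  have hC : IsCompact (B ∩ q ⁻¹' Set.Iic 0) :=
    hB.of_isClosed_subset (hqB.preimage_isClosed_of_isClosed hB.isClosed isClosed_Iic)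
      Set.inter_subset_left
  -- By compactness there is an earliest time at which the form is nonpositive in some direction.
  obtain ⟨⟨t₀, v₀⟩, ⟨⟨⟨ht0, htT⟩, hv₀⟩, hq₀⟩, hmin⟩ :=
    hC.exists_isMinOn ⟨(T, v), ⟨⟨hT, le_rfl⟩, hv⟩, hneg⟩ continuous_fst.continuousOn
  simp only [Set.mem_preimage, Set.mem_Iic] at hq₀ ht0 htT hv₀
  have hbefore : ∀ s, 0 ≤ s → s < t₀ → ∀ w ∈ Metric.sphere (0 : m → ℂ) 1, 0 < q (s, w) := by
    intro s hs hst w hw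
    by_contra! hle
    have := hmin (show (s, w) ∈ B ∩ q ⁻¹' Set.Iic 0 from ⟨⟨⟨hs, hst.le.trans htT⟩, hw⟩, hle⟩)
    exact absurd hst (not_lt.2 this)
  have htpos : 0 < t₀ := by
    rcases ht0.eq_or_lt with h | h
    · exfalso
      rw [← h, hqs] at hq₀
      have h1 := (Complex.nonneg_iff.1 (h0.dotProduct_mulVec_nonneg v₀)).1
      have h2 := hone v₀ hv₀
      have h3 : 0 < ε * Real.exp (c * 0) * (star v₀ ⬝ᵥ ((1 : Matrix m m ℂ) *ᵥ v₀)).re := by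
        positivity
      linarith
    · exact h
  have hpsd : (σ t₀).PosSemidef := by
    refine posSemidef_of_sphere ?_ fun w hw => ?_
    · refine (hherm t₀ ht0).add ?_
      rw [Matrix.IsHermitian, Matrix.conjTranspose_smul, Matrix.conjTranspose_one,
        Complex.star_def, Complex.conj_ofReal]
    · have hcw : ContinuousWithinAt (fun s => q (s, w)) (Set.Ico 0 t₀) t₀ := by
        have h1 : ContinuousOn (fun s => q (s, w)) (Set.Ici 0) :=
          hqc.comp (by fun_prop) fun s hs => ⟨hs, trivial⟩
        exact (h1 t₀ ht0).mono fun s hs => hs.1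
      have hmem : t₀ ∈ closure (Set.Ico 0 t₀) := by
        rw [closure_Ico htpos.ne]
        exact ⟨ht0, le_rfl⟩
      exact closure_minimal (s := (fun s => q (s, w)) '' Set.Ico 0 t₀) (t := Set.Ici 0)
        (by rintro _ ⟨s, hs, rfl⟩; exact (hbefore s hs.1 hs.2 w hw).le) isClosed_Ici
        (hcw.mem_closure_image hmem)
  have hre0 : (star v₀ ⬝ᵥ (σ t₀ *ᵥ v₀)).re = 0 :=
    le_antisymm hq₀ (Complex.nonneg_iff.1 (hpsd.dotProduct_mulVec_nonneg v₀)).1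
  -- A positive semidefinite matrix kills every vector on which its form vanishes, so the
  -- inward-pointing inequality applies at `v₀`.
  have hker : σ t₀ *ᵥ v₀ = 0 := by
    refine (hpsd.dotProduct_mulVec_zero_iff v₀).1 (Complex.ext hre0 ?_)
    exact hpsd.isHermitian.im_star_dotProduct_mulVec_self v₀
  let φ : Matrix m m ℂ →ₗ[ℝ] ℝ :=
    { toFun := fun X => (star v₀ ⬝ᵥ (X *ᵥ v₀)).re
      map_add' := fun X Y => by
        rw [Matrix.add_mulVec, dotProduct_add, Complex.add_re]
      map_smul' := fun a X => by
        rw [Matrix.smul_mulVec, dotProduct_smul, Complex.real_smul, Complex.re_ofReal_mul]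
        rfl }
  have hderiv : HasDerivAt (fun s => q (s, v₀)) (φ (lindbladian H L (ρ t₀)) +
      ε * (Real.exp (c * t₀) * c) * (star v₀ ⬝ᵥ ((1 : Matrix m m ℂ) *ᵥ v₀)).re) t₀ := by
    simp only [hqs]
    have h1 : HasDerivAt (fun s => (star v₀ ⬝ᵥ (ρ s *ᵥ v₀)).re) (φ (lindbladian H L (ρ t₀))) t₀ :=
      (hρ.hasDerivWithinAt_map φ ht0).hasDerivAt (Ici_mem_nhds htpos)
    have h2 : HasDerivAt (fun s => Real.exp (c * s)) (Real.exp (c * t₀) * c) t₀ := by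
      simpa using ((hasDerivAt_id t₀).const_mul c).exp
    exact h1.add ((h2.const_mul ε).mul_const _)
  have hnonneg := (Complex.nonneg_iff.1 (zero_le_lindbladian_of_mulVec_eq_zero H L hpsd hker)).1
  have hsplit : (star v₀ ⬝ᵥ (lindbladian H L (σ t₀) *ᵥ v₀)).re = φ (lindbladian H L (ρ t₀)) +
      ε * Real.exp (c * t₀) * (star v₀ ⬝ᵥ (lindbladian H L 1 *ᵥ v₀)).re := by
    have : lindbladian H L (σ t₀) = lindbladian H L (ρ t₀) +
        ((ε * Real.exp (c * t₀) : ℝ) : ℂ) • lindbladian H L 1 := by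
      simp only [← lindbladianLin_apply, hσ, map_add, map_smul]
    rw [this, Matrix.add_mulVec, Matrix.smul_mulVec, dotProduct_add, dotProduct_smul,
      Complex.add_re, smul_eq_mul, Complex.re_ofReal_mul]
    rfl
  have hslope := (hasDerivAt_iff_tendsto_slope_left_right.1 hderiv).1
  have hle : φ (lindbladian H L (ρ t₀)) +
      ε * (Real.exp (c * t₀) * c) * (star v₀ ⬝ᵥ ((1 : Matrix m m ℂ) *ᵥ v₀)).re ≤ 0 := by
    refine le_of_tendsto hslope ?_
    filter_upwards [Ioo_mem_nhdsLT htpos] with s hs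
    rw [slope_def_field]
    have h1 := hbefore s hs.1.le hs.2 v₀ hv₀
    have h2 : q (t₀, v₀) ≤ 0 := hq₀
    exact div_nonpos_of_nonneg_of_nonpos (by linarith) (by linarith [hs.2])
  -- The derivative exceeds the form of the generator at `σ t₀`, which is nonnegative; this
  -- contradicts the nonpositive left slope.
  have hcv := hc v₀ hv₀
  have hpos : 0 < ε * Real.exp (c * t₀) := by positivity
  nlinarith [mul_lt_mul_of_pos_left hcv hpos]

/-- The evolution generated by a Lindbladian preserves positivity. -/
theorem IsSolution.posSemidef {H : Matrix m m ℂ} (hH : H.IsHermitian)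
    {L : κ → Matrix m m ℂ} {ρ : ℝ → Matrix m m ℂ} (hρ : IsSolution (lindbladian H L) ρ)
    (h0 : (ρ 0).PosSemidef) {t : ℝ} (ht : 0 ≤ t) : (ρ t).PosSemidef := by
  classical
  -- The adjoint trajectory solves the same equation with the same initial value.
  have hherm : ∀ t, 0 ≤ t → (ρ t).IsHermitian := fun t ht =>
    IsSolution.unique (ℓ := lindbladianLin H L) (hρ.conjTranspose (lindbladian_conjTranspose hH L))
      hρ h0.isHermitian ht
  have hone := quadraticForm_one_pos (m := m)
  have hcont : ∀ X : Matrix m m ℂ, Continuous fun v : m → ℂ => (star v ⬝ᵥ (X *ᵥ v)).re := by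
    intro X
    fun_prop
  obtain ⟨b, hb⟩ := (isCompact_sphere (0 : m → ℂ) 1).bddAbove_image
    (f := fun v => (star v ⬝ᵥ (lindbladian H L 1 *ᵥ v)).re /
      (star v ⬝ᵥ ((1 : Matrix m m ℂ) *ᵥ v)).re)
    ((hcont _).continuousOn.div (hcont _).continuousOn fun v hv => (hone v hv).ne')
  have hc : ∀ v ∈ Metric.sphere (0 : m → ℂ) 1, (star v ⬝ᵥ (lindbladian H L 1 *ᵥ v)).re <
      (b + 1) * (star v ⬝ᵥ ((1 : Matrix m m ℂ) *ᵥ v)).re := by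
    intro v hv
    rw [← div_lt_iff₀ (hone v hv)]
    have := hb (Set.mem_image_of_mem _ hv)
    linarith
  refine posSemidef_of_sphere (hherm t ht) fun v hv => ?_
  -- The rate `b + 1` does not depend on `ε`, so the perturbation can be sent to zero.
  have hlim : Filter.Tendsto (fun ε : ℝ => (star v ⬝ᵥ (ρ t *ᵥ v)).re +
      ε * Real.exp ((b + 1) * t) * (star v ⬝ᵥ ((1 : Matrix m m ℂ) *ᵥ v)).re)
      (nhdsWithin 0 (Set.Ioi 0)) (nhds ((star v ⬝ᵥ (ρ t *ᵥ v)).re)) := by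
    have : Continuous (fun ε : ℝ => (star v ⬝ᵥ (ρ t *ᵥ v)).re +
      ε * Real.exp ((b + 1) * t) * (star v ⬝ᵥ ((1 : Matrix m m ℂ) *ᵥ v)).re) := by fun_prop
    have h := this.tendsto 0
    simp only [zero_mul, add_zero] at h
    exact h.mono_left nhdsWithin_le_nhds
  refine ge_of_tendsto hlim ?_
  filter_upwards [self_mem_nhdsWithin] with ε hε
  have := hρ.pos_of_lindbladian h0 hherm hc hε ht hv
  rw [Matrix.add_mulVec, Matrix.smul_mulVec, dotProduct_add, dotProduct_smul,
    Complex.add_re, smul_eq_mul, Complex.re_ofReal_mul] at this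
  exact this.le

theorem constant_of_hasDerivWithinAt_zero {f : ℝ → ℂ}
    (h : ∀ t, 0 ≤ t → HasDerivWithinAt f 0 (Set.Ici 0) t) {t : ℝ} (ht : 0 ≤ t) : f t = f 0 := by
  refine (convex_Ici (0 : ℝ)).is_const_of_fderivWithin_eq_zero (𝕜 := ℝ)
    (fun s hs => (h s hs).differentiableWithinAt) (fun s hs => ?_) ht (le_refl (0 : ℝ))
  have := (h s hs).hasFDerivWithinAt.fderivWithin (uniqueDiffOn_Ici (0 : ℝ) s hs)
  rw [this]
  ext
  simp

/-- The evolution generated by a Lindbladian takes density matrices to density matrices. -/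
theorem IsSolution.isDensity {H : Matrix m m ℂ} (hH : H.IsHermitian)
    {L : κ → Matrix m m ℂ} {ρ : ℝ → Matrix m m ℂ} (hρ : IsSolution (lindbladian H L) ρ)
    (h0 : IsDensity (ρ 0)) {t : ℝ} (ht : 0 ≤ t) : IsDensity (ρ t) := by
  refine ⟨hρ.posSemidef hH h0.1 ht, ?_⟩
  rw [← h0.2]
  refine constant_of_hasDerivWithinAt_zero (f := fun t => (ρ t).trace) (fun s hs => ?_) ht
  have := hρ.hasDerivWithinAt_map ((Matrix.traceLinearMap m ℂ ℂ).restrictScalars ℝ) hs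
  simpa [trace_lindbladian] using this

end ODE

end IIDLattice

namespace IIDLattice

open scoped Kronecker

variable {ι : Type*} {n : ℕ} [Fintype ι] [DecidableEq ι]

/-! ### The span of the physical states -/

theorem posSemidef_mem_span_physStates {K : Kind ι} {P : LocOp ι} (hP : P.PosSemidef)
    (hK : K.Conserving P) : P ∈ Submodule.span ℂ (physStates K) := by
  by_cases h : P.trace = 0
  · rw [hP.trace_eq_zero_iff.1 h]
    exact zero_mem _
  · have h1 : P = P.trace • (P.trace⁻¹ • P) := by rw [smul_smul, mul_inv_cancel₀ h, one_smul]
    rw [h1]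
    refine Submodule.smul_mem _ _ (Submodule.subset_span ⟨⟨?_, ?_⟩, ?_⟩)
    · exact hP.smul (inv_nonneg.2 hP.trace_nonneg)
    · rw [Matrix.trace_smul, smul_eq_mul, inv_mul_cancel₀ h]
    · exact K.conservingSubalgebra.smul_mem hK _

theorem mem_span_physStates_iff {K : Kind ι} {X : LocOp ι} :
    X ∈ Submodule.span ℂ (physStates K) ↔ K.Conserving X := by
  constructor
  · intro h
    exact Submodule.span_le (p := Subalgebra.toSubmodule K.conservingSubalgebra).2
      (fun ρ hρ => hρ.2) h
  · intro h
    have hP : ∀ c : ℂ, (X + c • 1) * (X + c • 1)ᴴ ∈ Submodule.span ℂ (physStates K) := by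
      intro c
      have hc : K.Conserving (X + c • 1) :=
        K.conservingSubalgebra.add_mem h
          (K.conservingSubalgebra.smul_mem K.conservingSubalgebra.one_mem c)
      exact posSemidef_mem_span_physStates (Matrix.posSemidef_self_mul_conjTranspose _)
        (K.conservingSubalgebra.mul_mem hc hc.conjTranspose)
    -- Polarization: summing `c • ((X + c) * (X + c)ᴴ)` over the fourth roots of unity leaves `4 •
    -- X`. Each summand is positive and conserving because the conserving operators form a
    -- subalgebra closed under adjoints.
    have hX : X = (1 / 4 : ℂ) • ((1 : ℂ) • ((X + (1 : ℂ) • 1) * (X + (1 : ℂ) • 1)ᴴ) +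
        Complex.I • ((X + Complex.I • 1) * (X + Complex.I • 1)ᴴ) +
        (-1 : ℂ) • ((X + (-1 : ℂ) • 1) * (X + (-1 : ℂ) • 1)ᴴ) +
        (-Complex.I) • ((X + (-Complex.I) • 1) * (X + (-Complex.I) • 1)ᴴ)) := by
      have hexp : ∀ c : ℂ, c • ((X + c • 1) * (X + c • 1)ᴴ) =
          c • (X * Xᴴ) + (c * star c) • X + (c * c) • Xᴴ + (c * (c * star c)) • 1 := by
        intro c
        simp only [Matrix.conjTranspose_add, Matrix.conjTranspose_smul, Matrix.conjTranspose_one,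
          mul_add, add_mul, mul_smul_comm, smul_mul_assoc, mul_one, one_mul, smul_add, smul_smul,
          mul_comm]
        abel
      rw [hexp, hexp, hexp, hexp]
      simp only [star_one, star_neg, Complex.star_def, Complex.conj_I, mul_neg, neg_mul,
        Complex.I_mul_I, neg_neg, mul_one, smul_add, smul_smul]
      module
    rw [hX]
    exact Submodule.smul_mem _ _ (add_mem (add_mem (add_mem (Submodule.smul_mem _ _ (hP _))
      (Submodule.smul_mem _ _ (hP _))) (Submodule.smul_mem _ _ (hP _)))
      (Submodule.smul_mem _ _ (hP _)))

theorem physStates_eqOn_iff {K : Kind ι} (f g : LocOp ι →ₗ[ℂ] LocOp ι) :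
    (∀ ρ ∈ physStates K, f ρ = g ρ) ↔ ∀ X, K.Conserving X → f X = g X := by
  constructor
  · intro h X hX
    exact Submodule.span_le (p := LinearMap.eqLocus f g).2 h (mem_span_physStates_iff.2 hX)
  · intro h ρ hρ
    exact h ρ hρ.2

/-! ### The commutant of the i.i.d. states without superselection rule -/

/-- Reduces the commutation with `iid n ρ` to a problem on two tensor factors, the other sites
contributing a common scalar. -/
theorem exists_matrix_of_mem_pairSpan {i j : Fin n} (hij : i ≠ j) {Z : Op n ι}
    (hZ : Z ∈ pairSpan .unrestricted i j) :
    ∃ M : Matrix (ι × ι) (ι × ι) ℂ, ∀ (ρ : LocOp ι) (x y : Fin n → ι),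
      (Z * iid n ρ) x y = (M * (ρ ⊗ₖ ρ)) (x i, x j) (y i, y j) *
        ∏ k ∈ (Finset.univ.erase i).erase j, ρ (x k) (y k) ∧
      (iid n ρ * Z) x y = ((ρ ⊗ₖ ρ) * M) (x i, x j) (y i, y j) *
        ∏ k ∈ (Finset.univ.erase i).erase j, ρ (x k) (y k) := by
  have hj : j ∈ Finset.univ.erase i := Finset.mem_erase.2 ⟨hij.symm, Finset.mem_univ j⟩
  refine Submodule.span_induction (p := fun Z _ =>
    ∃ M : Matrix (ι × ι) (ι × ι) ℂ, ∀ (ρ : LocOp ι) (x y : Fin n → ι),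
      (Z * iid n ρ) x y = (M * (ρ ⊗ₖ ρ)) (x i, x j) (y i, y j) *
        ∏ k ∈ (Finset.univ.erase i).erase j, ρ (x k) (y k) ∧
      (iid n ρ * Z) x y = ((ρ ⊗ₖ ρ) * M) (x i, x j) (y i, y j) *
        ∏ k ∈ (Finset.univ.erase i).erase j, ρ (x k) (y k)) ?_ ?_ ?_ ?_ hZ
  · rintro _ ⟨A, B, rfl⟩
    refine ⟨A ⊗ₖ B, fun ρ x y => ?_⟩
    have hiid : iid n ρ = tens fun _ => ρ := rfl
    rw [← Matrix.mul_kronecker_mul, ← Matrix.mul_kronecker_mul, siteOp_unrestricted,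
      siteOp_unrestricted, tens_mul, hiid, tens_mul, tens_mul]
    constructor
    all_goals
      rw [tens, Matrix.of_apply, ← Finset.mul_prod_erase _ _ (Finset.mem_univ i),
        ← Finset.mul_prod_erase _ _ hj, ← mul_assoc, Matrix.kroneckerMap_apply]
      congr 1
      · simp [Function.update_of_ne hij, Function.update_of_ne hij.symm]
      · refine Finset.prod_congr rfl fun k hk => ?_
        have h1 := Finset.ne_of_mem_erase hk
        have h2 := Finset.ne_of_mem_erase (Finset.mem_of_mem_erase hk)
        simp [Function.update_of_ne h1, Function.update_of_ne h2]
  · exact ⟨0, fun ρ x y => by simp⟩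
  · rintro Z W _ _ ⟨M, hM⟩ ⟨N, hN⟩
    refine ⟨M + N, fun ρ x y => ?_⟩
    rw [add_mul, mul_add, add_mul, mul_add]
    simp only [Matrix.add_apply, (hM ρ x y).1, (hM ρ x y).2, (hN ρ x y).1, (hN ρ x y).2, add_mul,
      and_self]
  · rintro c Z _ ⟨M, hM⟩
    refine ⟨c • M, fun ρ x y => ?_⟩
    rw [smul_mul_assoc, mul_smul_comm, smul_mul_assoc, mul_smul_comm]
    simp only [Matrix.smul_apply, (hM ρ x y).1, (hM ρ x y).2, smul_eq_mul, mul_assoc, and_self]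

/-- A matrix that commutes with `ρ ⊗ ρ` for every state `ρ` commutes with `A ⊗ A` for every `A`. -/
theorem commute_kronecker_of_density {M : Matrix (ι × ι) (ι × ι) ℂ}
    (hM : ∀ ρ : LocOp ι, IsDensity ρ → M * (ρ ⊗ₖ ρ) = (ρ ⊗ₖ ρ) * M) (A : LocOp ι) :
    M * (A ⊗ₖ A) = (A ⊗ₖ A) * M := by
  let C : LocOp ι →ₗ[ℂ] LocOp ι →ₗ[ℂ] Matrix (ι × ι) (ι × ι) ℂ := LinearMap.mk₂ ℂ
    (fun A B => M * (A ⊗ₖ B) - (A ⊗ₖ B) * M)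
    (fun A A' B => by rw [Matrix.add_kronecker, mul_add, add_mul]; abel)
    (fun c A B => by rw [Matrix.smul_kronecker, mul_smul_comm, smul_mul_assoc, smul_sub])
    (fun A B B' => by rw [Matrix.kronecker_add, mul_add, add_mul]; abel)
    (fun c A B => by rw [Matrix.kronecker_smul, mul_smul_comm, smul_mul_assoc, smul_sub])
  -- The symmetrized commutator is bilinear. It vanishes on pairs of states, as one sees by
  -- evaluating the quadratic version at their midpoint; since states span, it vanishes everywhere.
  let S := C + C.flip
  have hC : ∀ A B, C A B = M * (A ⊗ₖ B) - (A ⊗ₖ B) * M := fun _ _ => rfl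
  have hC0 : ∀ ρ : LocOp ι, IsDensity ρ → C ρ ρ = 0 := fun ρ hρ => by rw [hC, hM ρ hρ, sub_self]
  have hS : ∀ ρ σ : LocOp ι, IsDensity ρ → IsDensity σ → S ρ σ = 0 := by
    intro ρ σ hρ hσ
    have hτ : IsDensity ((1 / 2 : ℂ) • (ρ + σ)) := by
      refine ⟨(hρ.1.add hσ.1).smul (by rw [Complex.nonneg_iff]; norm_num), ?_⟩
      rw [Matrix.trace_smul, Matrix.trace_add, hρ.2, hσ.2]
      norm_num
    have h := hC0 _ hτ
    simp only [map_smul, map_add, LinearMap.smul_apply, LinearMap.add_apply, hC0 ρ hρ, hC0 σ hσ,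
      zero_add, add_zero] at h
    have h' := (smul_eq_zero.1 h).resolve_left (by norm_num)
    rw [add_comm, ← smul_add] at h'
    exact (smul_eq_zero.1 h').resolve_left (by norm_num)
  have hspan : ∀ X : LocOp ι, X ∈ Submodule.span ℂ {ρ : LocOp ι | IsDensity ρ} := by
    intro X
    have : physStates (Kind.unrestricted : Kind ι) = {ρ | IsDensity ρ} :=
      Set.ext fun ρ => ⟨fun h => h.1, fun h => ⟨h, trivial⟩⟩
    rw [← this]
    exact mem_span_physStates_iff.2 trivial
  have hS2 : ∀ ρ : LocOp ι, IsDensity ρ → ∀ B, S ρ B = 0 := fun ρ hρ B =>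
    Submodule.span_le (p := LinearMap.ker (S ρ)).2 (fun σ hσ => hS ρ σ hρ hσ) (hspan B)
  have hS3 : S A A = 0 :=
    Submodule.span_le (p := LinearMap.ker (S.flip A)).2 (fun σ hσ => hS2 σ hσ A) (hspan A)
  have h4 : (2 : ℂ) • C A A = 0 := by rw [two_smul]; exact hS3
  have h5 := (smul_eq_zero.1 h4).resolve_left two_ne_zero
  rw [hC, sub_eq_zero] at h5
  exact h5

theorem exists_diag_ne_zero {ρ : LocOp ι} (hρ : IsDensity ρ) : ∃ c, ρ c c ≠ 0 := by
  by_contra! h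
  have := hρ.2
  simp [Matrix.trace, h] at this

theorem exists_perm_pair {a b c e : ι} (hab : a ≠ b) (hce : c ≠ e) :
    ∃ σ : Equiv.Perm ι, σ a = c ∧ σ b = e := by
  refine ⟨(Equiv.swap a c).trans (Equiv.swap (Equiv.swap a c b) e), ?_, ?_⟩
  · rw [Equiv.trans_apply, Equiv.swap_apply_left, Equiv.swap_apply_of_ne_of_ne _ hce]
    intro h
    have := congrArg (Equiv.swap a c) h
    rw [Equiv.swap_apply_right, Equiv.swap_apply_self] at this
    exact hab this
  · rw [Equiv.trans_apply, Equiv.swap_apply_left]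

/-- The commutant of the operators `A ⊗ A` is spanned by the identity and the exchange. -/
theorem exists_of_commute_kronecker {M : Matrix (ι × ι) (ι × ι) ℂ}
    (hM : ∀ A : LocOp ι, M * (A ⊗ₖ A) = (A ⊗ₖ A) * M) :
    ∃ u v : ℂ, ∀ p q r s, M (p, q) (r, s) =
      (if p = r ∧ q = s then u else 0) + (if p = s ∧ q = r then v else 0) := by
  -- Diagonal test matrices force the two index pairs to agree as multisets; the weight 2 at `p`,
  -- then at `q`, counts multiplicities.
  have hdiag : ∀ p q r s, M (p, q) (r, s) ≠ 0 → (p = r ∧ q = s) ∨ (p = s ∧ q = r) := by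
    intro p q r s h0
    have hf : ∀ f : ι → ℂ, f r * f s = f p * f q := by
      intro f
      have h := congrFun (congrFun (hM (Matrix.diagonal f)) (p, q)) (r, s)
      rw [Matrix.diagonal_kronecker_diagonal, Matrix.mul_diagonal, Matrix.diagonal_mul,
        mul_comm] at h
      exact mul_right_cancel₀ h0 h
    have h1 := hf fun k => if k = p then 2 else 1
    have h2 := hf fun k => if k = q then 2 else 1
    simp only [if_true] at h1 h2
    clear hf h0
    split_ifs at h1 h2 <;> first
      | (exfalso; norm_num at h1; done)
      | (exfalso; norm_num at h2; done)
      | grind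
  -- Permutation matrices make the entries constant on orbits, so one pair of distinct indices
  -- determines all entries with distinct row indices.
  have hperm : ∀ (σ : Equiv.Perm ι) p q r s,
      M (σ p, σ q) (σ r, σ s) = M (p, q) (r, s) := by
    intro σ p q r s
    have h := congrFun (congrFun (hM (Matrix.of fun a b => if σ a = b then 1 else 0)) (p, q))
      (σ r, σ s)
    rw [Matrix.mul_apply, Matrix.mul_apply, Fintype.sum_prod_type, Fintype.sum_prod_type] at h
    simpa [Matrix.kroneckerMap_apply, ite_and, σ.injective.eq_iff] using h.symm
  -- The all-ones matrix equates every row sum with every column sum. This ties the entry at a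
  -- repeated index to `u + v`, which permutations alone cannot do.
  have hrow : ∀ p q r s, ∑ z, M (p, q) z = ∑ z, M z (r, s) := by
    intro p q r s
    have h := congrFun (congrFun (hM (Matrix.of fun _ _ => 1)) (p, q)) (r, s)
    rw [Matrix.mul_apply, Matrix.mul_apply] at h
    simpa [Matrix.kroneckerMap_apply] using h
  by_cases hex : ∃ a b : ι, a ≠ b
  · obtain ⟨a, b, hab⟩ := hex
    refine ⟨M (a, b) (a, b), M (a, b) (b, a), fun p q r s => ?_⟩
    by_cases h0 : M (p, q) (r, s) = 0 ∧ ¬(p = r ∧ q = s) ∧ ¬(p = s ∧ q = r)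
    · rw [h0.1, if_neg h0.2.1, if_neg h0.2.2, add_zero]
    have hor : (p = r ∧ q = s) ∨ (p = s ∧ q = r) := by
      by_cases hz : M (p, q) (r, s) = 0
      · by_contra hcon
        exact h0 ⟨hz, not_or.1 hcon⟩
      · exact hdiag p q r s hz
    by_cases hpq : p = q
    · subst hpq
      have hrs : r = p ∧ s = p := by rcases hor with ⟨h1, h2⟩ | ⟨h1, h2⟩ <;> simp [← h1, ← h2]
      obtain ⟨rfl, rfl⟩ := hrs
      simp only [and_self, if_true]
      have h := hrow s s a b
      rw [Finset.sum_eq_single_of_mem (s, s) (Finset.mem_univ _)] at h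
      · rw [h, ← Finset.add_sum_erase _ _ (Finset.mem_univ (a, b)),
          Finset.sum_eq_single_of_mem (b, a)]
        · obtain ⟨σ, h1, h2⟩ := exists_perm_pair hab hab.symm
          have := hperm σ a b b a
          rw [h1, h2] at this
          rw [this]
        · simp [hab.symm]
        · rintro ⟨c, e⟩ hz hne
          by_contra hcon
          rcases hdiag _ _ _ _ hcon with ⟨h1, h2⟩ | ⟨h1, h2⟩
          · subst h1 h2
            simp at hz
          · subst h1 h2
            simp at hne
      · rintro ⟨c, e⟩ _ hne
        by_contra hcon
        rcases hdiag _ _ _ _ hcon with ⟨h1, h2⟩ | ⟨h1, h2⟩ <;> simp [← h1, ← h2] at hne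
    · obtain ⟨σ, h1, h2⟩ := exists_perm_pair hab hpq
      rcases hor with ⟨rfl, rfl⟩ | ⟨rfl, rfl⟩
      · have := hperm σ a b a b
        rw [h1, h2] at this
        simp [this, hpq]
      · have := hperm σ a b b a
        rw [h1, h2] at this
        simp [this, hpq]
  · push Not at hex
    rcases isEmpty_or_nonempty ι with he | ⟨⟨a⟩⟩
    · exact ⟨0, 0, fun p => (he.false p).elim⟩
    · refine ⟨M (a, a) (a, a), 0, fun p q r s => ?_⟩
      rw [hex p a, hex q a, hex r a, hex s a]
      simp

theorem swapOp_commute_iid (i j : Fin n) (ρ : LocOp ι) : Commute (swapOp i j) (iid n ρ) := by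
  ext x y
  have hs : ∀ x z : Fin n → ι, x = z ∘ Equiv.swap i j ↔ z = x ∘ Equiv.swap i j := by
    intro x z
    constructor
    · rintro rfl
      funext k
      simp
    · rintro rfl
      funext k
      simp
  rw [Matrix.mul_apply, Matrix.mul_apply]
  simp only [swapOp, Matrix.of_apply, hs x, ite_mul, one_mul, zero_mul, mul_ite, mul_one, mul_zero,
    Finset.sum_ite_eq', Finset.mem_univ, if_true, iid]
  rw [← Equiv.prod_comp (Equiv.swap i j)]
  simp

theorem mem_Bcom_unrestricted_iff {i j : Fin n} (hij : i ≠ j) {Z : Op n ι}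
    (hZ : Z ∈ pairSpan .unrestricted i j) :
    Z ∈ Bcom n .unrestricted ↔ Z ∈ Submodule.span ℂ {(1 : Op n ι), swapOp i j} := by
  constructor
  · intro hB
    obtain ⟨M, hM⟩ := exists_matrix_of_mem_pairSpan hij hZ
    have hcomm : ∀ ρ : LocOp ι, IsDensity ρ → M * (ρ ⊗ₖ ρ) = (ρ ⊗ₖ ρ) * M := by
      intro ρ hρ
      obtain ⟨c, hc⟩ := exists_diag_ne_zero hρ
      have hB' := hB ρ ⟨hρ, trivial⟩
      ext ⟨p, q⟩ ⟨r, s⟩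
      -- The other sites sit in a state `c` with `ρ c c ≠ 0`, so their factor can be cancelled.
      have hprod := hM ρ (Function.update (Function.update (fun _ => c) i p) j q)
        (Function.update (Function.update (fun _ => c) i r) j s)
      rw [hB'.eq] at hprod
      have h := hprod.1.symm.trans hprod.2
      simp only [Function.update_self, Function.update_of_ne hij] at h
      refine mul_right_cancel₀ ?_ h
      refine Finset.prod_ne_zero_iff.2 fun k hk => ?_
      rw [Function.update_of_ne (Finset.ne_of_mem_erase hk),
        Function.update_of_ne (Finset.ne_of_mem_erase hk),
        Function.update_of_ne (Finset.ne_of_mem_erase (Finset.mem_of_mem_erase hk)),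
        Function.update_of_ne (Finset.ne_of_mem_erase (Finset.mem_of_mem_erase hk))]
      exact hc
    obtain ⟨u, v, huv⟩ := exists_of_commute_kronecker (commute_kronecker_of_density hcomm)
    rw [Submodule.mem_span_pair]
    refine ⟨u, v, ?_⟩
    ext x y
    -- At `ρ = 1` the tensor power is the identity, and the formula reads off the entries of `Z`
    -- itself.
    have h := (hM 1 x y).1
    rw [iid_one, mul_one, Matrix.one_kronecker_one, mul_one, huv] at h
    rw [h, Matrix.add_apply, Matrix.smul_apply, Matrix.smul_apply, swapOp, Matrix.of_apply,
      Matrix.one_apply, smul_eq_mul, smul_eq_mul, mul_ite, mul_ite, mul_one, mul_one, mul_zero,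
      mul_zero]
    by_cases hag : ∀ k ∈ (Finset.univ.erase i).erase j, x k = y k
    · rw [Finset.prod_eq_one, mul_one]
      · congr 1
        · refine if_congr ?_ rfl rfl
          constructor
          · rintro rfl
            exact ⟨rfl, rfl⟩
          · rintro ⟨h1, h2⟩
            funext k
            by_cases hk : k = i
            · rw [hk, h1]
            by_cases hk' : k = j
            · rw [hk', h2]
            · exact hag k (by simp [hk, hk'])
        · refine if_congr ?_ rfl rfl
          constructor
          · rintro rfl
            simp
          · rintro ⟨h1, h2⟩
            funext k
            by_cases hk : k = i
            · rw [hk, h1]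
              simp
            by_cases hk' : k = j
            · rw [hk', h2]
              simp
            · rw [Function.comp_apply, Equiv.swap_apply_of_ne_of_ne hk hk']
              exact hag k (by simp [hk, hk'])
      · intro k hk
        rw [hag k hk, Matrix.one_apply_eq]
    · push Not at hag
      obtain ⟨k, hk, hne⟩ := hag
      have h1 : k ≠ j := Finset.ne_of_mem_erase hk
      have h2 : k ≠ i := Finset.ne_of_mem_erase (Finset.mem_of_mem_erase hk)
      rw [if_neg fun h => hne (by rw [h]), if_neg, Finset.prod_eq_zero (i := k) hk, mul_zero,
        add_zero]
      · exact Matrix.one_apply_ne hne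
      · intro h
        apply hne
        rw [h, Function.comp_apply, Equiv.swap_apply_of_ne_of_ne h2 h1]
  · intro h ρ _
    obtain ⟨u, v, rfl⟩ := Submodule.mem_span_pair.1 h
    exact ((Commute.one_left _).smul_left u).add_left ((swapOp_commute_iid i j ρ).smul_left v)

end IIDLattice

namespace IIDLattice

variable {ι : Type*} {n : ℕ} [Fintype ι] [DecidableEq ι]

/-! ### The lattice Lindbladian on i.i.d. states -/

theorem dissipator_siteOp_iid (K : Kind ι) (i : Fin n) {ρ : LocOp ι} (hρ : K.IsEven ρ)
    (A : LocOp ι) : dissipator (siteOp K i A) (iid n ρ) = dressed K i ρ (dissipator A ρ) := by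
  rw [dissipator, dissipator, siteOp_conjTranspose, siteOp_mul, siteOp_mul_iid K i hρ,
    siteOp_mul_iid K i hρ, iid_mul_siteOp K i hρ, dressed_mul_siteOp K i hρ, map_sub, map_smul,
    map_add]

theorem commutator_siteOp_iid (K : Kind ι) (i : Fin n) {ρ : LocOp ι} (hρ : K.IsEven ρ)
    (A : LocOp ι) : siteOp K i A * iid n ρ - iid n ρ * siteOp K i A =
      dressed K i ρ (A * ρ - ρ * A) := by
  rw [siteOp_mul_iid K i hρ, iid_mul_siteOp K i hρ, map_sub]

theorem latticeLindbladian_iid [Nonempty ι] {K : Kind ι} {H : Op n ι} (hH : H ∈ twoBodySpan n K)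
    {Γ : Fin n → Type*} [∀ i, Fintype (Γ i)] (L : (i : Fin n) → Γ i → LocOp ι)
    {ρ : LocOp ι} (hρ : K.IsEven ρ) :
    latticeLindbladian K H L (iid n ρ) =
      ∑ i, dressed K i ρ (siteLindbladian K H L i ρ) - Complex.I • ∑ i, ∑ j ∈ Finset.Ioi i,
        (irrTwo K H i j * iid n ρ - iid n ρ * irrTwo K H i j) := by
  have hcomm : H * iid n ρ - iid n ρ * H =
      ∑ i, dressed K i ρ (irrOne K H i * ρ - ρ * irrOne K H i) + ∑ i, ∑ j ∈ Finset.Ioi i,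
        (irrTwo K H i j * iid n ρ - iid n ρ * irrTwo K H i j) := by
    nth_rewrite 1 [two_body_decomposition hH]
    -- After the first rewriting three occurrences of `H` sit inside the coefficients; the fourth is
    -- the right-hand factor of the commutator.
    nth_rewrite 4 [two_body_decomposition hH]
    simp only [add_mul, mul_add, smul_mul_assoc, mul_smul_comm, one_mul, mul_one, Finset.sum_mul,
      Finset.mul_sum, ← commutator_siteOp_iid K _ hρ, Finset.sum_sub_distrib]
    abel
  rw [latticeLindbladian, lindbladian, hcomm, Fintype.sum_sigma]
  simp only [dissipator_siteOp_iid K _ hρ, siteLindbladian, lindbladian, map_add, map_sum, map_smul,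
    map_neg, Finset.sum_add_distrib, smul_add, Finset.smul_sum, neg_smul, Finset.sum_neg_distrib]
  abel

/-- Needed so that the single-site evolution preserves positivity. -/
theorem irrOne_isHermitian (K : Kind ι) {H : Op n ι} (hH : H.IsHermitian) (i : Fin n) :
    (irrOne K H i).IsHermitian := by
  have h1 : (ptrOne K i H)ᴴ = ptrOne K i H := by
    ext a b
    rw [Matrix.conjTranspose_apply, ptrOne, Matrix.of_apply, Matrix.of_apply,
      ← Matrix.trace_conjTranspose, Matrix.conjTranspose_mul, hH.eq,
      Matrix.conjTranspose_conjTranspose, siteOp_conjTranspose, Matrix.conjTranspose_single,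
      star_one, Matrix.trace_mul_comm]
  have h2 : star H.trace = H.trace := by
    rw [← Matrix.trace_conjTranspose, hH.eq]
  rw [Matrix.IsHermitian, irrOne, Matrix.conjTranspose_sub, Matrix.conjTranspose_smul,
    Matrix.conjTranspose_smul, h1, Matrix.conjTranspose_one, star_div₀, h2, star_inv₀, star_pow,
    star_pow, star_natCast]

/-! ### Physical states -/

open scoped MatrixOrder Matrix.Norms.L2Operator in
theorem exists_eq_conjTranspose_mul_self {P : LocOp ι} (hP : P.PosSemidef) :
    ∃ B : LocOp ι, P = Bᴴ * B :=
  CStarAlgebra.nonneg_iff_eq_star_mul_self.1 hP.nonneg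

theorem isDensity_iid {ρ : LocOp ι} (hρ : IsDensity ρ) : IsDensity (iid n ρ) := by
  refine ⟨?_, by rw [trace_iid, hρ.2, one_pow]⟩
  obtain ⟨B, rfl⟩ := exists_eq_conjTranspose_mul_self hρ.1
  rw [← iid_mul, ← iid_conjTranspose]
  exact Matrix.posSemidef_conjTranspose_mul_self _

theorem eq_zero_of_hasDerivWithinAt {f : ℝ → ℂ} {f' : ℂ}
    (h : HasDerivWithinAt f f' (Set.Ici 0) 0) (h0 : ∀ t, 0 ≤ t → f t = 0) : f' = 0 :=
  (uniqueDiffOn_Ici (0 : ℝ) 0 (le_refl (0 : ℝ))).eq_deriv _ h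
    ((hasDerivWithinAt_const (0 : ℝ) (Set.Ici 0) (0 : ℂ)).congr (fun t ht => h0 t ht)
      (h0 0 le_rfl))

/-- Entries between different total charges vanish along the trajectory from `iid n ρ`, hence so do
their derivatives at time 0. -/
theorem totalConserving_latticeLindbladian {K : Kind ι} {H : Op n ι}
    {Γ : Fin n → Type*} [∀ i, Fintype (Γ i)] {L : (i : Fin n) → Γ i → LocOp ι}
    (hK : RespectsSuperselection K (latticeLindbladian K H L)) {ρ : LocOp ι}
    (hρ : ρ ∈ physStates K) : K.TotalConserving (latticeLindbladian K H L (iid n ρ)) := by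
  obtain ⟨σ, hσ, hσ0⟩ := exists_isSolution
    (lindbladianLin H fun p : (Σ i, Γ i) => siteOp K p.1 (L p.1 p.2)) (iid n ρ)
  have hcons := hK σ hσ (by rw [hσ0]; exact isDensity_iid hρ.1) (by rw [hσ0]; exact hρ.2.iid)
  rw [Kind.totalConserving_iff]
  intro x y hxy
  by_contra hne
  apply hxy
  have h := hσ 0 le_rfl x y
  rw [hσ0] at h
  refine eq_zero_of_hasDerivWithinAt h fun t ht => ?_
  by_contra h0
  exact hne ((K.totalConserving_iff _).1 (hcons t ht) x y h0)

/-- A charge-changing entry of `X` is isolated by placing `a, b` on site `i₀` and a populated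
diagonal state elsewhere: every other summand contains the factor `ρ a b = 0`. -/
theorem conserving_of_totalConserving_sum {K : Kind ι} (i₀ : Fin n) {ρ X : LocOp ι}
    (hρ : ρ ∈ physStates K) (h : K.TotalConserving (∑ i : Fin n, dressed K i ρ X)) :
    K.Conserving X := by
  rw [Kind.conserving_iff]
  intro a b hab
  by_contra hne
  obtain ⟨c, hc⟩ := exists_diag_ne_zero hρ.1
  set x : Fin n → ι := Function.update (fun _ => c) i₀ a with hx
  set y : Fin n → ι := Function.update (fun _ => c) i₀ b with hy
  have hoff : ∀ k ∈ Finset.univ.erase i₀, x k = c ∧ y k = c := fun k hk => by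
    rw [hx, hy, Function.update_of_ne (Finset.ne_of_mem_erase hk),
      Function.update_of_ne (Finset.ne_of_mem_erase hk)]
    exact ⟨rfl, rfl⟩
  have hρab : ρ a b = 0 := by
    by_contra h0
    exact hne ((K.conserving_iff ρ).1 hρ.2 a b h0)
  have hxy : (∑ i : Fin n, dressed K i ρ X) x y = 0 := by
    by_contra h0
    have h1 := (K.totalConserving_iff _).1 h x y h0
    rw [← Finset.add_sum_erase _ _ (Finset.mem_univ i₀),
      ← Finset.add_sum_erase _ (fun k => K.charge (y k)) (Finset.mem_univ i₀),
      Finset.sum_congr rfl fun k hk => by rw [(hoff k hk).1, ← (hoff k hk).2], add_left_inj,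
      hx, hy, Function.update_self, Function.update_self] at h1
    exact hne h1
  rw [Matrix.sum_apply, Finset.sum_eq_single_of_mem i₀ (Finset.mem_univ i₀)] at hxy
  · rw [dressed_apply] at hxy
    have h1 := (mul_eq_zero.1 hxy).resolve_left (pow_ne_zero _ (by norm_num))
    rcases mul_eq_zero.1 h1 with h2 | h2
    · rw [hx, hy, Function.update_self, Function.update_self] at h2
      exact hab h2
    · refine absurd h2 (Finset.prod_ne_zero_iff.2 fun k hk => ?_)
      rw [(hoff k hk).1, (hoff k hk).2]
      exact hc
  · intro i _ hi
    rw [dressed_apply, Finset.prod_eq_zero (i := i₀) (by simpa using hi.symm), mul_zero, mul_zero]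
    rw [hx, hy, Function.update_self, Function.update_self, hρab]

theorem hasDerivWithinAt_iid {τ : ℝ → LocOp ι} {τ' : LocOp ι} {s : Set ℝ} {t : ℝ}
    (h : ∀ a b, HasDerivWithinAt (fun u => τ u a b) (τ' a b) s t) (x y : Fin n → ι) :
    HasDerivWithinAt (fun u => iid n (τ u) x y)
      (∑ i, τ' (x i) (y i) * ∏ k ∈ Finset.univ.erase i, τ t (x k) (y k)) s t := by
  refine (HasDerivWithinAt.fun_finsetProd (u := Finset.univ)
    (f := fun k u => τ u (x k) (y k)) fun k _ => h (x k) (y k)).congr_deriv ?_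
  simp only [smul_eq_mul, mul_comm]

/-! ### Sufficiency -/

section

variable [Nonempty ι] {K : Kind ι} {H : Op n ι} {Γ : Fin n → Type*} [∀ i, Fintype (Γ i)]
  {L : (i : Fin n) → Γ i → LocOp ι}

theorem latticeLindbladian_iid_of_mem_Bcom (hH : H ∈ twoBodySpan n K)
    (hB : ∀ i j, i < j → irrTwo K H i j ∈ Bcom n K) {ρ : LocOp ι} (hρ : ρ ∈ physStates K) :
    latticeLindbladian K H L (iid n ρ) = ∑ i, dressed K i ρ (siteLindbladian K H L i ρ) := by
  rw [latticeLindbladian_iid hH L hρ.2.isEven]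
  have : ∑ i : Fin n, ∑ j ∈ Finset.Ioi i,
      (irrTwo K H i j * iid n ρ - iid n ρ * irrTwo K H i j) = 0 :=
    Finset.sum_eq_zero fun i _ => Finset.sum_eq_zero fun j hj =>
      sub_eq_zero.2 (hB i j (Finset.mem_Ioi.1 hj) ρ hρ)
  rw [this, smul_zero, sub_zero]

/-- Under the condition on the irreducible parts, an evolution of the single-site states lifts to
the lattice. -/
theorem exists_singleSite_evolution (hH : H ∈ twoBodySpan n K) (hHerm : H.IsHermitian)
    (hK : RespectsSuperselection K (latticeLindbladian K H L))
    (hB : ∀ i j, i < j → irrTwo K H i j ∈ Bcom n K)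
    (hU : IsUniform K (siteLindbladian K H L)) {ρ₀ : LocOp ι} (h₀ : ρ₀ ∈ physStates K) :
    ∃ (ℓ : LocOp ι → LocOp ι) (τ : ℝ → LocOp ι), IsSolution ℓ τ ∧ τ 0 = ρ₀ ∧
      (∀ t, 0 ≤ t → τ t ∈ physStates K) ∧ (∀ ρ ∈ physStates K, K.Conserving (ℓ ρ)) ∧
      ∀ i, ∀ ρ ∈ physStates K, siteLindbladian K H L i ρ = ℓ ρ := by
  rcases Nat.eq_zero_or_pos n with hn | hn
  · subst hn
    refine ⟨fun _ => 0, fun _ => ρ₀, fun t _ x y => hasDerivWithinAt_const _ _ _, rfl,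
      fun _ _ => h₀, fun _ _ => K.conservingSubalgebra.zero_mem, fun i => i.elim0⟩
  · let i₀ : Fin n := ⟨0, hn⟩
    have hcons : ∀ ρ ∈ physStates K, K.Conserving (siteLindbladian K H L i₀ ρ) := by
      intro ρ hρ
      have h := totalConserving_latticeLindbladian hK hρ
      rw [latticeLindbladian_iid_of_mem_Bcom hH hB hρ,
        Finset.sum_congr rfl fun i _ => by rw [hU i i₀ ρ hρ]] at h
      exact conserving_of_totalConserving_sum i₀ hρ h
    let ℓ := lindbladianLin (irrOne K H i₀) (L i₀)
    -- Conservation is known at states only; linearity extends it to their span, which is an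
    -- invariant subspace in which the equation can be solved.
    have hℓ : ∀ X ∈ Subalgebra.toSubmodule K.conservingSubalgebra,
        ℓ X ∈ Subalgebra.toSubmodule K.conservingSubalgebra := by
      intro X hX
      exact Submodule.span_le
        (p := (Subalgebra.toSubmodule K.conservingSubalgebra).comap ℓ).2
        (fun ρ hρ => hcons ρ hρ) (mem_span_physStates_iff.2 hX)
    obtain ⟨τ, h1, h2, h3⟩ := exists_isSolution_mem ℓ
      (Subalgebra.toSubmodule K.conservingSubalgebra) hℓ (ρ₀ := ρ₀) h₀.2
    refine ⟨ℓ, τ, h1, h2, fun t ht => ⟨?_, h3 t⟩, hcons, fun i ρ hρ => hU i i₀ ρ hρ⟩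
    exact IsSolution.isDensity (irrOne_isHermitian K hHerm i₀) h1 (by rw [h2]; exact h₀.1) ht

theorem maintainsIID_of_mem_Bcom_of_isUniform (hH : H ∈ twoBodySpan n K) (hHerm : H.IsHermitian)
    (hK : RespectsSuperselection K (latticeLindbladian K H L))
    (hB : ∀ i j, i < j → irrTwo K H i j ∈ Bcom n K)
    (hU : IsUniform K (siteLindbladian K H L)) :
    MaintainsIID K (latticeLindbladian K H L) := by
  intro ρ₀ h₀ ρ hρ hρ0 t ht
  obtain ⟨ℓ, τ, hτ, hτ0, hphys, hcons, hℓ⟩ := exists_singleSite_evolution hH hHerm hK hB hU h₀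
  refine ⟨τ t, hphys t ht, ?_⟩
  refine IsSolution.unique (τ := fun t => iid n (τ t))
    (ℓ := lindbladianLin H fun p : (Σ i, Γ i) => siteOp K p.1 (L p.1 p.2)) hρ ?_
    (by rw [hρ0, hτ0]) ht
  intro s hs x y
  refine (hasDerivWithinAt_iid (hτ s hs) x y).congr_deriv ?_
  have h := latticeLindbladian_iid_of_mem_Bcom (L := L) hH hB (hphys s hs)
  change _ = latticeLindbladian K H L (iid n (τ s)) x y
  rw [h, Matrix.sum_apply]
  refine Finset.sum_congr rfl fun i _ => ?_
  rw [hℓ i _ (hphys s hs), dressed_apply_of_isEven K i _ (hcons _ (hphys s hs)).isEven]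

/-! ### Necessity -/

/-- Recovers the single-site state linearly from the lattice state. The embedding without exchange
signs is used for every kind, since `iid` is a plain tensor product. -/
theorem trace_iid_mul_siteOp (i : Fin n) {τ : LocOp ι} (hτ : τ.trace = 1) (a b : ι) :
    (iid n τ * siteOp .unrestricted i (Matrix.single b a 1)).trace = τ a b := by
  have hiid : iid n τ = tens fun _ => τ := rfl
  rw [siteOp_unrestricted, hiid, tens_mul, trace_tens,
    ← Finset.mul_prod_erase _ _ (Finset.mem_univ i), Finset.prod_eq_one, Function.update_self,
    Matrix.trace_mul_single]
  · simp
  · intro k hk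
    rw [Function.update_of_ne (Finset.ne_of_mem_erase hk), mul_one, hτ]

/-- The states `τ t` are merely chosen at each time. They are differentiable at 0 because a linear
functional of the lattice state returns their entries; the product rule then gives the velocity. -/
theorem MaintainsIID.exists_derivative
    (hM : MaintainsIID K (latticeLindbladian K H L)) (i₀ : Fin n) {ρ₀ : LocOp ι}
    (h₀ : ρ₀ ∈ physStates K) : ∃ σ : LocOp ι, σ.trace = 0 ∧
      latticeLindbladian K H L (iid n ρ₀) = ∑ i, dressed K i ρ₀ σ := by
  obtain ⟨ρ, hρ, hρ0⟩ := exists_isSolution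
    (lindbladianLin H fun p : (Σ i, Γ i) => siteOp K p.1 (L p.1 p.2)) (iid n ρ₀)
  have hex : ∀ t, ∃ τ, 0 ≤ t → τ ∈ physStates K ∧ ρ t = iid n τ := by
    intro t
    by_cases ht : 0 ≤ t
    · obtain ⟨τ, h1, h2⟩ := hM ρ₀ h₀ ρ hρ hρ0 t ht
      exact ⟨τ, fun _ => ⟨h1, h2⟩⟩
    · exact ⟨0, fun h => absurd h ht⟩
  choose τ hτ using hex
  let φ : ι → ι → Op n ι →ₗ[ℝ] ℂ := fun a b =>
    ((Matrix.traceLinearMap (Fin n → ι) ℂ ℂ).comp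
      (LinearMap.mulRight ℂ (siteOp .unrestricted i₀ (Matrix.single b a 1)))).restrictScalars ℝ
  have hφ : ∀ a b t, 0 ≤ t → φ a b (ρ t) = τ t a b := by
    intro a b t ht
    rw [(hτ t ht).2]
    exact trace_iid_mul_siteOp i₀ (hτ t ht).1.1.2 a b
  have hτ0 : τ 0 = ρ₀ := by
    ext a b
    rw [← hφ a b 0 le_rfl, hρ0]
    exact trace_iid_mul_siteOp i₀ h₀.1.2 a b
  let σ : LocOp ι := Matrix.of fun a b => φ a b (latticeLindbladian K H L (iid n ρ₀))
  have hσ : ∀ a b, HasDerivWithinAt (fun t => τ t a b) (σ a b) (Set.Ici 0) 0 := by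
    intro a b
    have h := hρ.hasDerivWithinAt_map (φ a b) le_rfl
    rw [hρ0] at h
    exact h.congr (fun t ht => (hφ a b t ht).symm) (hφ a b 0 le_rfl).symm
  have hσtr : σ.trace = 0 := by
    have h : HasDerivWithinAt (fun t => ∑ a, τ t a a - 1) (∑ a, σ a a) (Set.Ici 0) 0 :=
      (HasDerivWithinAt.fun_sum fun a _ => hσ a a).sub_const 1
    exact eq_zero_of_hasDerivWithinAt h fun t ht => sub_eq_zero.2 (hτ t ht).1.1.2
  have hσK : K.Conserving σ := by
    rw [Kind.conserving_iff]
    intro a b hab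
    by_contra hne
    refine hab (eq_zero_of_hasDerivWithinAt (hσ a b) fun t ht => ?_)
    by_contra h0
    exact hne ((K.conserving_iff _).1 (hτ t ht).1.2 a b h0)
  refine ⟨σ, hσtr, ?_⟩
  ext x y
  have h1 := hρ 0 le_rfl x y
  rw [hρ0] at h1
  have h2 := hasDerivWithinAt_iid hσ x y
  rw [hτ0] at h2
  have h3 := (uniqueDiffOn_Ici (0 : ℝ) 0 (le_refl (0 : ℝ))).eq_deriv _ h1
    (h2.congr (fun t ht => by rw [(hτ t ht).2]) (by rw [(hτ 0 le_rfl).2]))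
  change _ = _ at h3
  rw [Matrix.sum_apply]
  refine h3.trans (Finset.sum_congr rfl fun i _ => ?_)
  rw [dressed_apply_of_isEven K i _ hσK.isEven]

theorem iid_mul_siteOp_eq_conj (i : Fin n) {ρ r : LocOp ι} (hρ : K.IsEven ρ) (hr : r * ρ = 1)
    (A : LocOp ι) : iid n ρ * siteOp K i A = siteOp K i (ρ * A * r) * iid n ρ := by
  rw [iid_mul_siteOp K i hρ, siteOp_mul_iid K i hρ, mul_assoc, hr, mul_one]

/-- Moving the i.i.d. state across conjugates each one-site factor by `ρ`, which preserves its
trace. -/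
theorem exists_mem_irrSpan_iid_mul {i j : Fin n} {ρ r : LocOp ι} (hρ : K.IsEven ρ)
    (hr : r * ρ = 1) {Z : Op n ι} (hZ : Z ∈ irrSpan K i j) :
    ∃ Y ∈ irrSpan K i j, iid n ρ * Z = Y * iid n ρ := by
  have htr : ∀ A : LocOp ι, (ρ * A * r).trace = A.trace := fun A => by
    rw [Matrix.trace_mul_comm, ← mul_assoc, hr, one_mul]
  refine Submodule.span_induction
    (p := fun Z _ => ∃ Y ∈ irrSpan K i j, iid n ρ * Z = Y * iid n ρ) ?_ ?_ ?_ ?_ hZ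
  · rintro _ ⟨A, B, hA, hB, rfl⟩
    refine ⟨siteOp K i (ρ * A * r) * siteOp K j (ρ * B * r),
      Submodule.subset_span ⟨_, _, by rw [htr, hA], by rw [htr, hB], rfl⟩, ?_⟩
    rw [← mul_assoc, iid_mul_siteOp_eq_conj i hρ hr, mul_assoc (siteOp K i _),
      iid_mul_siteOp_eq_conj j hρ hr, mul_assoc (siteOp K i _)]
  · exact ⟨0, zero_mem _, by simp⟩
  · rintro _ _ _ _ ⟨Y, hY, h1⟩ ⟨Y', hY', h2⟩
    exact ⟨Y + Y', add_mem hY hY', by rw [mul_add, add_mul, h1, h2]⟩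
  · rintro c _ _ ⟨Y, hY, h1⟩
    exact ⟨c • Y, Submodule.smul_mem _ _ hY, by rw [mul_smul_comm, smul_mul_assoc, h1]⟩

/-- At an invertible state, the velocity of an i.i.d. state determines both the two-site and the
one-site parts of the generator. -/
theorem commute_and_eq_of_invertible (hH : H ∈ twoBodySpan n K) {ρ r σ : LocOp ι}
    (hρ : ρ ∈ physStates K) (hr : r * ρ = 1) (hσ : σ.trace = 0)
    (h : latticeLindbladian K H L (iid n ρ) = ∑ i, dressed K i ρ σ) :
    (∀ i j, i < j → Commute (irrTwo K H i j) (iid n ρ)) ∧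
      ∀ i, siteLindbladian K H L i ρ = σ := by
  have hev := hρ.2.isEven
  have hr' : ρ * r = 1 := mul_eq_one_comm.1 hr
  have hinv : iid n ρ * iid n r = 1 := by rw [iid_mul, hr', iid_one]
  have hY : ∀ i j, ∃ Y, i < j → Y ∈ irrSpan K i j ∧
      iid n ρ * irrTwo K H i j = Y * iid n ρ := by
    intro i j
    by_cases hij : i < j
    · obtain ⟨Y, h1, h2⟩ := exists_mem_irrSpan_iid_mul hev hr (irrTwo_mem_irrSpan hH hij)
      exact ⟨Y, fun _ => ⟨h1, h2⟩⟩
    · exact ⟨0, fun h => absurd h hij⟩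
  choose Y hY using hY
  have hdress : ∀ i X, dressed K i ρ X = siteOp K i (X * r) * iid n ρ := fun i X => by
    rw [siteOp_mul_iid K i hev, mul_assoc, hr, mul_one]
  have hid : (∑ i, siteOp K i ((siteLindbladian K H L i ρ - σ) * r)) * iid n ρ =
      (∑ i, ∑ j ∈ Finset.Ioi i, Complex.I • (irrTwo K H i j - Y i j)) * iid n ρ := by
    have h1 : (∑ i, siteOp K i ((siteLindbladian K H L i ρ - σ) * r)) * iid n ρ =
        ∑ i, dressed K i ρ (siteLindbladian K H L i ρ) - ∑ i, dressed K i ρ σ := by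
      rw [Finset.sum_mul, ← Finset.sum_sub_distrib]
      refine Finset.sum_congr rfl fun i _ => ?_
      rw [← hdress, map_sub]
    have h2 : (∑ i, ∑ j ∈ Finset.Ioi i, Complex.I • (irrTwo K H i j - Y i j)) * iid n ρ =
        Complex.I • ∑ i, ∑ j ∈ Finset.Ioi i,
        (irrTwo K H i j * iid n ρ - iid n ρ * irrTwo K H i j) := by
      rw [Finset.sum_mul, Finset.smul_sum]
      refine Finset.sum_congr rfl fun i _ => ?_
      rw [Finset.sum_mul, Finset.smul_sum]
      refine Finset.sum_congr rfl fun j hj => ?_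
      rw [(hY i j (Finset.mem_Ioi.1 hj)).2, smul_mul_assoc, sub_mul]
    rw [h1, h2, ← h, latticeLindbladian_iid hH L hev, sub_sub_cancel]
  -- Cancelling the i.i.d. state leaves an identity between one-site operators and irreducible
  -- two-site operators.
  have hid' := congrArg (· * iid n r) hid
  simp only [mul_assoc, hinv, mul_one] at hid'
  obtain ⟨h2, h1⟩ := eq_zero_of_sum_siteOp_eq_sum_irr (fun i j hij => Submodule.smul_mem _ _
    (sub_mem (irrTwo_mem_irrSpan hH hij) (hY i j hij).1)) hid'
  constructor
  · intro i j hij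
    have h3 := (smul_eq_zero.1 (h2 i j hij)).resolve_left Complex.I_ne_zero
    have h4 := (hY i j hij).2
    rw [← sub_eq_zero.1 h3] at h4
    exact h4.symm
  · intro i
    obtain ⟨c, hc⟩ := h1 i
    have h3 : siteLindbladian K H L i ρ - σ = c • ρ := by
      have := congrArg (· * ρ) hc
      simpa [mul_assoc, hr] using this
    -- Both velocities are traceless and `ρ` has trace 1, so the scalar `c` vanishes.
    have h4 := congrArg Matrix.trace h3
    rw [Matrix.trace_sub, siteLindbladian, trace_lindbladian, hσ, Matrix.trace_smul, hρ.1.2,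
      smul_eq_mul, mul_one, sub_zero] at h4
    rw [← h4, zero_smul] at h3
    exact sub_eq_zero.1 h3

/-- The mixture of `ρ` with the maximally mixed state. -/
def mixture (ρ : LocOp ι) (s : ℝ) : LocOp ι :=
  ((1 - s : ℝ) : ℂ) • ρ + ((s / Fintype.card ι : ℝ) : ℂ) • 1

theorem mixture_mem_physStates {ρ : LocOp ι} (hρ : ρ ∈ physStates K) {s : ℝ}
    (hs : s ∈ Set.Ioc (0 : ℝ) 1) : mixture ρ s ∈ physStates K ∧ ∃ r, r * mixture ρ s = 1 := by
  have hcard : (0 : ℝ) < Fintype.card ι := by exact_mod_cast Fintype.card_pos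
  have h1 : (((1 - s : ℝ) : ℂ) • ρ).PosSemidef :=
    hρ.1.1.smul (Complex.zero_le_real.2 (by linarith [hs.2]))
  have h2 : (((s / Fintype.card ι : ℝ) : ℂ) • (1 : LocOp ι)).PosDef :=
    Matrix.PosDef.one.smul (Complex.zero_lt_real.2 (div_pos hs.1 hcard))
  have h3 : (mixture ρ s).PosDef := Matrix.PosDef.posSemidef_add h1 h2
  refine ⟨⟨⟨h3.posSemidef, ?_⟩, ?_⟩, ?_⟩
  · rw [mixture, Matrix.trace_add, Matrix.trace_smul, Matrix.trace_smul, hρ.1.2, Matrix.trace_one]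
    have := card_ne_zero_complex (ι := ι)
    push_cast
    simp only [smul_eq_mul]
    field_simp
    ring
  · exact K.conservingSubalgebra.add_mem (K.conservingSubalgebra.smul_mem hρ.2 _)
      (K.conservingSubalgebra.smul_mem K.conservingSubalgebra.one_mem _)
  · obtain ⟨u, hu⟩ := h3.isUnit
    exact ⟨(u⁻¹ : (LocOp ι)ˣ), by rw [← hu, Units.inv_mul]⟩

theorem MaintainsIID.mem_Bcom (hH : H ∈ twoBodySpan n K)
    (hM : MaintainsIID K (latticeLindbladian K H L)) {i j : Fin n} (hij : i < j) :
    irrTwo K H i j ∈ Bcom n K := by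
  intro ρ hρ
  ext x y
  rw [← sub_eq_zero, ← Matrix.sub_apply]
  -- The commutator entry is continuous along the mixtures and zero for `0 < s ≤ 1`, where the
  -- mixture is invertible; hence it is zero at `s = 0`.
  let f : ℝ → ℂ := fun s => (irrTwo K H i j * iid n (mixture ρ s) -
    iid n (mixture ρ s) * irrTwo K H i j) x y
  have hf : Continuous f := by
    simp only [f, Matrix.sub_apply, Matrix.mul_apply, iid, Matrix.of_apply, mixture,
      Matrix.add_apply, Matrix.smul_apply, smul_eq_mul]
    fun_prop
  have h0 : mixture ρ 0 = ρ := by simp [mixture]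
  have hzero : ∀ s ∈ Set.Ioc (0 : ℝ) 1, f s = 0 := by
    intro s hs
    obtain ⟨h1, r, hr⟩ := mixture_mem_physStates hρ hs
    obtain ⟨σ, hσ, h2⟩ := hM.exists_derivative i h1
    have := (commute_and_eq_of_invertible hH h1 hr hσ h2).1 i j hij
    simp only [f, this.eq, sub_self, Matrix.zero_apply]
  have hclosed : IsClosed {s | f s = 0} := isClosed_eq hf continuous_const
  have hmem : (0 : ℝ) ∈ closure (Set.Ioc (0 : ℝ) 1) := by
    rw [closure_Ioc (by norm_num)]
    exact ⟨le_rfl, zero_le_one⟩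
  have h : f 0 = 0 := closure_minimal (fun s hs => hzero s hs) hclosed hmem
  simpa only [f, h0] using h

theorem MaintainsIID.isUniform (hH : H ∈ twoBodySpan n K)
    (hM : MaintainsIID K (latticeLindbladian K H L)) :
    IsUniform K (siteLindbladian K H L) := by
  intro i j ρ hρ
  have key : ∀ s ∈ Set.Ioc (0 : ℝ) 1, siteLindbladian K H L i (mixture ρ s) =
      siteLindbladian K H L j (mixture ρ s) := by
    intro s hs
    obtain ⟨h1, r, hr⟩ := mixture_mem_physStates hρ hs
    obtain ⟨σ, hσ, h2⟩ := hM.exists_derivative i h1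
    have h := (commute_and_eq_of_invertible hH h1 hr hσ h2).2
    rw [h i, h j]
  let f := lindbladianLin (irrOne K H i) (L i)
  let g := lindbladianLin (irrOne K H j) (L j)
  change f ρ = g ρ
  have h1 : f (mixture ρ 1) = g (mixture ρ 1) := key 1 ⟨one_pos, le_rfl⟩
  have h2 : f (mixture ρ (1 / 2)) = g (mixture ρ (1 / 2)) := key (1 / 2) (by norm_num)
  -- Two invertible states on the segment determine its endpoint linearly, so no limit is needed.
  have h3 : ρ = (2 : ℂ) • mixture ρ (1 / 2) - mixture ρ 1 := by
    simp only [mixture]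
    push_cast
    module
  rw [h3, map_sub, map_sub, map_smul, map_smul, h1, h2]

end

end IIDLattice

end

theorem theorem8 {ι : Type*} [Fintype ι] [DecidableEq ι] (n : ℕ) (K : Kind ι)
    (H : Op n ι) (hH : IsTwoBody K H)
    {Γ : Fin n → Type*} [∀ i, Fintype (Γ i)] (L : (i : Fin n) → Γ i → LocOp ι)
    (hK : RespectsSuperselection K (latticeLindbladian K H L)) :
    (MaintainsIID K (latticeLindbladian K H L) ↔
      (∀ i j, i < j → irrTwo K H i j ∈ Bcom n K) ∧ IsUniform K (siteLindbladian K H L)) ∧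
    (Submodule.span ℂ (physStates K) : Set (LocOp ι)) = {X | K.Conserving X} ∧
    (IsUniform K (siteLindbladian K H L) ↔
      ∀ i j, ∀ X, K.Conserving X → siteLindbladian K H L i X = siteLindbladian K H L j X) ∧
    (K = Kind.unrestricted → ∀ i j, i < j →
      (irrTwo K H i j ∈ Bcom n K ↔
        irrTwo K H i j ∈ Submodule.span ℂ {(1 : Op n ι), swapOp i j})) := by
  refine ⟨?_, Set.ext fun X => mem_span_physStates_iff, ?_, ?_⟩
  · rcases isEmpty_or_nonempty ι with hι | hι
    -- On a zero-dimensional site there is no matrix of trace 1, so both conditions hold vacuously.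
    · have hno : ∀ ρ, ρ ∉ physStates K := fun ρ hρ =>
        (exists_diag_ne_zero hρ.1).elim fun c _ => hι.false c
      exact ⟨fun _ => ⟨fun i j _ ρ hρ => absurd hρ (hno ρ), fun i j ρ hρ => absurd hρ (hno ρ)⟩,
        fun _ ρ hρ => absurd hρ (hno ρ)⟩
    · have hspan := hH.mem_twoBodySpan
      exact ⟨fun hM => ⟨fun i j hij => hM.mem_Bcom hspan hij, hM.isUniform hspan⟩,
        fun h => maintainsIID_of_mem_Bcom_of_isUniform hspan hH.isHermitian hK h.1 h.2⟩
  · exact forall_congr' fun i => forall_congr' fun j => physStates_eqOn_iff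
      (lindbladianLin (irrOne K H i) (L i)) (lindbladianLin (irrOne K H j) (L j))
  · rintro rfl i j hij
    rcases isEmpty_or_nonempty ι with hι | hι
    · have : IsEmpty (Fin n → ι) := ⟨fun x => hι.false (x i)⟩
      rw [Subsingleton.elim (irrTwo _ H i j) 0]
      exact ⟨fun _ => zero_mem _, fun _ ρ _ => Commute.zero_left _⟩
    · exact mem_Bcom_unrestricted_iff hij.ne
        (irrSpan_le_pairSpan _ i j (irrTwo_mem_irrSpan hH.mem_twoBodySpan hij))
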